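/- Work on $[0,\infty)\times\mathbb R^3$ with Cartesian coordinates $(T,X)$, $R=|X|$, flat metric of signature $(-,+,+,+)$ and $\square=-\partial_T^2+\partial_1^2+\partial_2^2+\partial_3^2$. For $R\neq 0$ let $\nabla_{\underline\psi}=\partial_T-\partial_R$. At $T=0$ time derivatives are one-sided. Let $\Gamma$ range over the eleven vector fields $\partial_T$, $\partial_i$, $X_i\partial_j-X_j\partial_i$ ($i<j$), $X_i\partial_T+T\partial_i$ and $T\partial_T+X^i\partial_i$, and write $\Gamma^I=\Gamma_{I_1}\cdots\Gamma_{I_k}$, $|I|=k$, for finite sequences $I$. Put $E[f](T)=\bigl(\tfrac12\int_{\mathbb R^3}((\partial_Tf)^2+|\nabla f|^2)(T,X)\,dX\bigr)^{1/2}$. (A) For every $\rho$ there is a constant $C$, depending only on $\rho$, such that the following holds. Let $\phi$ be smooth on $[0,\infty)\times(\mathbb R^3\setminus\{0\})$ and satisfy there the ugly equation with $p=1$ and $F=0$, $$\square\phi=\frac{2}{R}\,\partial_T\phi,$$ let $\phi_1=R\,\nabla_{\underline\psi}\phi$, set equal to $0$ at $R=0$, be smooth on $[0,\infty)\times\mathbb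 R^3$ (this is automatic if $\phi$ itself is smooth at $R=0$), and let $\phi$ and $\partial_T\phi$ vanish at $T=0$ for $R>\rho$. Then: 1. $\square\phi_1=0$ on $[0,\infty)\times\mathbb R^3$. 2. For every $I$ the function $\Gamma^I\phi_1$ is smooth on $[0,\infty)\times\mathbb R^3$, $\square\Gamma^I\phi_1=0$, its energy density is integrable on every slice of constant $T\ge 0$, and $E[\Gamma^I\phi_1](T)=E[\Gamma^I\phi_1](0)$ for all $T\ge 0$. 3. For all $T\ge 0$ and $X\in\mathbb R^3$, $$(1+T+R)\,(1+|T-R|)^{1/2}\,|\phi_1(T,X)|\le C\sum_{|I|\le 2}E[\Gamma^I\phi_1](0).$$ 4. For all $T\ge 0$ and $X\neq 0$, $$|\nabla_{\underline\psi}\phi(T,X)|\le\frac{C}{R\,(1+T+R)}\sum_{|I|\le 2}E[\Gamma^I\phi_1](0).$$ (B) The rate in 4 is one order in $R^{-1}$ better than for good fields: there are a smooth solution $g$ of $\square g=0$ on $[0,\infty)\times\mathbb R^3$ with compactly supported initial data, a unit vector $e\in\mathbb R^3$ and $u\in\mathbb R$ such that, along the outgoing null ray $T=u+R$, $X=Re$,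 the quantity $R\,\nabla_{\underline\psi}g$ has a nonzero limit as $R\to\infty$. -/

import Mathlib

open scoped ContDiff
open Filter Topology MeasureTheory

noncomputable section

/-- Space with its Euclidean norm; the radial coordinate of `X` is `‖X‖`. -/
abbrev Space3 : Type := EuclideanSpace ℝ (Fin 3)

/-- Points `(T, X)` in global inertial Cartesian coordinates. -/
abbrev Spacetime : Type := ℝ × Space3

/-- The region `[0, ∞) × ℝ³`. -/
def futureRegion : Set Spacetime := {p | 0 ≤ p.1}

/-- The region `[0, ∞) × (ℝ³ ∖ {0})`. -/
def offAxisRegion : Set Spacetime := {p | 0 ≤ p.1 ∧ p.2 ≠ 0}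

/-- Derivative of `f` along the vector field `v`, taken within `[0, ∞) × ℝ³`
(so it is one-sided in time on the initial slice and the usual one at positive times). -/
def dirDeriv (v : Spacetime → Spacetime) (f : Spacetime → ℝ) : Spacetime → ℝ :=
  fun p => fderivWithin ℝ f futureRegion p (v p)

/-- The `i`-th Cartesian basis vector of space. -/
def spaceBasis (i : Fin 3) : Space3 := EuclideanSpace.single i 1

/-- The vector field `∂_T`. -/
def vecT : Spacetime → Spacetime := fun _ => (1, 0)

/-- The vector field `∂_i`. -/
def vecX (i : Fin 3) : Spacetime → Spacetime := fun _ => (0, spaceBasis i)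

/-- The incoming null vector field `∂_T - ∂_R`, used only where `R ≠ 0`. -/
def vecPsiBar : Spacetime → Spacetime := fun p => (1, -(‖p.2‖⁻¹ • p.2))

/-- The wave operator `-∂_T² + ∂_1² + ∂_2² + ∂_3²` of the flat metric of signature `(-,+,+,+)`. -/
def waveOp (f : Spacetime → ℝ) : Spacetime → ℝ :=
  fun p => -dirDeriv vecT (dirDeriv vecT f) p
    + ∑ i : Fin 3, dirDeriv (vecX i) (dirDeriv (vecX i) f) p

/-- `φ` is smooth on `[0, ∞) × (ℝ³ ∖ {0})` and satisfies there the ugly equation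
`□φ = (2p/R) ∂_T φ + F`. -/
structure IsUglySolution (p : ℕ) (F φ : Spacetime → ℝ) : Prop where
  smooth : ContDiffOn ℝ ∞ φ offAxisRegion
  eqn : ∀ x ∈ offAxisRegion,
    waveOp φ x = 2 * (p : ℝ) / ‖x.2‖ * dirDeriv vecT φ x + F x

/-- `g` is smooth on `[0, ∞) × ℝ³` and satisfies there the good equation `□g = 0`. -/
structure IsGoodSolution (g : Spacetime → ℝ) : Prop where
  smooth : ContDiffOn ℝ ∞ g futureRegion
  eqn : ∀ x ∈ futureRegion, waveOp g x = 0

/-- The initial data `(φ, ∂_T φ)` at `T = 0` vanish outside the ball of radius `ρ`. -/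
def DataSupportedIn (ρ : ℝ) (φ : Spacetime → ℝ) : Prop :=
  ∀ X : Space3, ρ < ‖X‖ → φ (0, X) = 0 ∧ dirDeriv vecT φ (0, X) = 0

/-- The rescaled derivative `R ∇_ψ̄ φ` (it has the value `0` on the axis `R = 0`). -/
def rescaledPsiBar (φ : Spacetime → ℝ) : Spacetime → ℝ :=
  fun p => ‖p.2‖ * dirDeriv vecPsiBar φ p

/-- Labels of the eleven commuting vector fields: four translations, the three spatial
rotations with `i < j`, three Lorentz boosts and the dilation. -/
inductive GammaIdx : Type
  | timeTranslation : GammaIdx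
  | translation : Fin 3 → GammaIdx
  | rotation : { ij : Fin 3 × Fin 3 // ij.1 < ij.2 } → GammaIdx
  | boost : Fin 3 → GammaIdx
  | dilation : GammaIdx

instance instFintypeGammaIdx : Fintype GammaIdx :=
  Fintype.ofEquiv
    (Unit ⊕ Fin 3 ⊕ { ij : Fin 3 × Fin 3 // ij.1 < ij.2 } ⊕ Fin 3 ⊕ Unit)
    { toFun := fun s => match s with
        | .inl _ => .timeTranslation
        | .inr (.inl i) => .translation i
        | .inr (.inr (.inl ij)) => .rotation ij
        | .inr (.inr (.inr (.inl i))) => .boost i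
        | .inr (.inr (.inr (.inr _))) => .dilation
      invFun := fun q => match q with
        | .timeTranslation => .inl ()
        | .translation i => .inr (.inl i)
        | .rotation ij => .inr (.inr (.inl ij))
        | .boost i => .inr (.inr (.inr (.inl i)))
        | .dilation => .inr (.inr (.inr (.inr ())))
      left_inv := by rintro (_ | _ | _ | _ | _) <;> rfl
      right_inv := by rintro (_ | _ | _ | _ | _) <;> rfl }

/-- The vector fields `∂_T`, `∂_i`, `X_i ∂_j - X_j ∂_i`, `X_i ∂_T + T ∂_i`, `T ∂_T + X^i ∂_i`. -/
def gammaVec : GammaIdx → Spacetime → Spacetime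
  | .timeTranslation => vecT
  | .translation i => vecX i
  | .rotation ij => fun p =>
      p.2 ij.1.1 • vecX ij.1.2 p - p.2 ij.1.2 • vecX ij.1.1 p
  | .boost i => fun p => p.2 i • vecT p + p.1 • vecX i p
  | .dilation => fun p => p

/-- `Γ^I f = Γ_{I_1} (Γ_{I_2} ( ⋯ (Γ_{I_k} f)))` for the list `I = [I_1, …, I_k]`. -/
def gammaPow (I : List GammaIdx) (f : Spacetime → ℝ) : Spacetime → ℝ :=
  I.foldr (fun q h => dirDeriv (gammaVec q) h) f

/-- The integrand `(∂_T f)² + ∑ (∂_i f)²` of the energy on the slice of constant `T`. -/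
def energyDensity (f : Spacetime → ℝ) (T : ℝ) (X : Space3) : ℝ :=
  dirDeriv vecT f (T, X) ^ 2 + ∑ i : Fin 3, dirDeriv (vecX i) f (T, X) ^ 2

/-- The energy norm `E(T)`, with `E(T)² = ½ ∫ ((∂_T f)² + |∇f|²) dX`. -/
def energy (f : Spacetime → ℝ) (T : ℝ) : ℝ :=
  Real.sqrt ((1 / 2) * ∫ X : Space3, energyDensity f T X)

/-- The sum of the initial energies of `Γ^I f` over all `I` with `|I| ≤ 2`. -/
def initialGammaEnergy (f : Spacetime → ℝ) : ℝ :=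
  ∑ k ∈ Finset.range 3, ∑ I : Fin k → GammaIdx, energy (gammaPow (List.ofFn I) f) 0

end

/-!
Write `R = |X|` and `f = R ∇_ψ̄ φ = R ∂_T φ - X^i ∂_i φ`.

The ugly equation is exactly what makes `f` a solution of the homogeneous wave equation: the
commutator of `□` with `R ∂_T - X^i ∂_i` is `(2/R)(1 + X^i ∂_i) ∂_T - 2Δ`, which cancels
against the derivatives of the right-hand side `(2/R) ∂_T φ`
(`IsUglySolution.waveOp_rescaledPsiBar_offAxis`). As `f` is smooth, the equation holds on the
axis by continuity, and the ugly equation at `T = 0` shows that the data of `f` are supported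
where those of `φ` are. Each of the eleven fields has affine coefficients and commutes with `□` up
to a multiple of `□`, so every `Γ^I f` is a solution too (`IsGoodSolution.gamma`).

The quantitative statements rest on Kirchhoff's formula (`IsGoodSolution.kirchhoff`). Along the
backward cone of a point, the `s`-derivative of the spherical mean of `f + s (∂_T + ∂_s) f` is the
mean of a Laplacian of the sphere. That Laplacian is a sum of squares of rotation fields, and each
has vanishing mean because the surface measure is invariant under isometries
(`integral_sphere_laplacian`). The formula gives the strong Huygens principle: `f` vanishes unless
`|T - R| ≤ ρ`. Hence every `Γ^I f` has compact support on each slice, the energy density is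
integrable, and integrating the divergence identity for its time derivative gives conservation
(`IsGoodSolution.energy_eq`).

On the support of `f` the weight `1 + T + R` is comparable to `1 + T` and `1 + |T - R|` is bounded,
with constants depending on `ρ`, so what is needed is `(1 + T) |f| ≤ C ∑ E[Γ^I f](0)`. In Kirchhoff's
formula the data on the sphere of radius `T` about `x` are written as integrals of their radial
derivatives along the rays leaving that sphere outwards. There `s ≥ T`, so powers of `T` are
absorbed into the weight `s²` of polar coordinates, and `(1 + T) |f|` is bounded by `L¹` norms over
space of derivatives of the data (`IsGoodSolution.decay`). Cauchy–Schwarz on the ball of radius `ρ`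
turns these into energies of `Γ^I f` with at most two translations
(`IsGoodSolution.integral_dataDensity_le`).

For good fields the sharpness example is the outgoing wave `H(T - R) / R` with `H` supported in
`[-2, -1]`: at times `T ≥ 0` it vanishes near the axis, so it is smooth, and
`R ∇_ψ̄` of it equals `2 H'(u) + H(u) / R` on the ray `T - R = u`.
-/

/-! ### Calculus of directional derivatives within the future region -/

/-- The constant-coefficient derivative of `f` in the direction `e`, one-sided at `T = 0`. -/
noncomputable def cDeriv (e : Spacetime) (f : Spacetime → ℝ) : Spacetime → ℝ :=
  dirDeriv (fun _ => e) f

/-- The spacetime vector `∂_T`. -/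
def eT : Spacetime := (1, 0)

/-- The spacetime vector `∂_i`. -/
noncomputable def eX (i : Fin 3) : Spacetime := (0, spaceBasis i)

lemma dirDeriv_vecT (f : Spacetime → ℝ) : dirDeriv vecT f = cDeriv eT f := rfl

lemma waveOp_eq (f : Spacetime → ℝ) (p : Spacetime) :
    waveOp f p = -cDeriv eT (cDeriv eT f) p + ∑ i, cDeriv (eX i) (cDeriv (eX i) f) p := rfl

lemma convex_futureRegion : Convex ℝ futureRegion :=
  (convex_Ici (0 : ℝ)).is_linear_preimage (f := fun p : Spacetime => p.1)
    ⟨fun _ _ => rfl, fun _ _ => rfl⟩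

lemma isOpen_futureInterior : IsOpen {p : Spacetime | 0 < p.1} :=
  isOpen_lt continuous_const continuous_fst

lemma futureInterior_subset_interior : {p : Spacetime | 0 < p.1} ⊆ interior futureRegion :=
  interior_maximal (fun p (hp : 0 < p.1) => hp.le) isOpen_futureInterior

lemma uniqueDiffOn_futureRegion : UniqueDiffOn ℝ futureRegion :=
  uniqueDiffOn_convex convex_futureRegion
    ⟨(1, 0), futureInterior_subset_interior (by simp)⟩

lemma futureRegion_subset_closure_interior : futureRegion ⊆ closure (interior futureRegion) := by
  rw [convex_futureRegion.closure_interior_eq_closure_of_nonempty_interior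
    ⟨(1, 0), futureInterior_subset_interior (by simp)⟩]
  exact subset_closure

section Local

variable {U : Set Spacetime} {f g : Spacetime → ℝ} {p : Spacetime}

lemma inter_mem_nhdsWithin_future (hU : IsOpen U) (hp : p ∈ futureRegion ∩ U) :
    futureRegion ∩ U ∈ 𝓝[futureRegion] p :=
  inter_mem_nhdsWithin _ (hU.mem_nhds hp.2)

lemma contDiffWithinAt_future (hU : IsOpen U) (hf : ContDiffOn ℝ ∞ f (futureRegion ∩ U))
    (hp : p ∈ futureRegion ∩ U) : ContDiffWithinAt ℝ ∞ f futureRegion p :=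
  (hf p hp).mono_of_mem_nhdsWithin (inter_mem_nhdsWithin_future hU hp)

lemma hasFDerivWithinAt_future (hU : IsOpen U) (hf : ContDiffOn ℝ ∞ f (futureRegion ∩ U))
    (hp : p ∈ futureRegion ∩ U) :
    HasFDerivWithinAt f (fderivWithin ℝ f futureRegion p) futureRegion p :=
  ((contDiffWithinAt_future hU hf hp).differentiableWithinAt (by simp)).hasFDerivWithinAt

lemma contDiffOn_fderivWithin_future (hU : IsOpen U)
    (hf : ContDiffOn ℝ ∞ f (futureRegion ∩ U)) :
    ContDiffOn ℝ ∞ (fderivWithin ℝ f futureRegion) (futureRegion ∩ U) := by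
  refine (hf.fderivWithin (m := ∞) (uniqueDiffOn_futureRegion.inter hU) (by simp)).congr ?_
  intro p hp
  exact (fderivWithin_inter (hU.mem_nhds hp.2)).symm

lemma contDiffOn_dirDeriv {v : Spacetime → Spacetime} (hU : IsOpen U)
    (hv : ContDiffOn ℝ ∞ v (futureRegion ∩ U)) (hf : ContDiffOn ℝ ∞ f (futureRegion ∩ U)) :
    ContDiffOn ℝ ∞ (dirDeriv v f) (futureRegion ∩ U) :=
  (contDiffOn_fderivWithin_future hU hf).clm_apply hv

lemma contDiffOn_cDeriv (e : Spacetime) (hU : IsOpen U)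
    (hf : ContDiffOn ℝ ∞ f (futureRegion ∩ U)) :
    ContDiffOn ℝ ∞ (cDeriv e f) (futureRegion ∩ U) :=
  contDiffOn_dirDeriv hU contDiffOn_const hf

lemma contDiffOn_waveOp (hU : IsOpen U) (hf : ContDiffOn ℝ ∞ f (futureRegion ∩ U)) :
    ContDiffOn ℝ ∞ (waveOp f) (futureRegion ∩ U) := by
  refine ContDiffOn.add (contDiffOn_cDeriv _ hU (contDiffOn_cDeriv _ hU hf)).neg ?_
  exact ContDiffOn.sum fun i _ => contDiffOn_cDeriv _ hU (contDiffOn_cDeriv _ hU hf)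

lemma dirDeriv_congr (v : Spacetime → Spacetime) (hU : IsOpen U)
    (h : Set.EqOn f g (futureRegion ∩ U)) :
    Set.EqOn (dirDeriv v f) (dirDeriv v g) (futureRegion ∩ U) := by
  intro p hp
  have : f =ᶠ[𝓝[futureRegion] p] g := by
    filter_upwards [inter_mem_nhdsWithin_future hU hp] with q hq using h hq
  simp only [dirDeriv]
  rw [this.fderivWithin_eq (h hp)]

lemma cDeriv_congr (e : Spacetime) (hU : IsOpen U) (h : Set.EqOn f g (futureRegion ∩ U)) :
    Set.EqOn (cDeriv e f) (cDeriv e g) (futureRegion ∩ U) :=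
  dirDeriv_congr _ hU h

lemma waveOp_congr (hU : IsOpen U) (h : Set.EqOn f g (futureRegion ∩ U)) :
    Set.EqOn (waveOp f) (waveOp g) (futureRegion ∩ U) := by
  intro p hp
  simp only [waveOp_eq]
  rw [cDeriv_congr eT hU (cDeriv_congr eT hU h) hp]
  congr 1
  exact Finset.sum_congr rfl fun i _ => cDeriv_congr _ hU (cDeriv_congr _ hU h) hp

lemma dirDeriv_zero_fun (v : Spacetime → Spacetime) : dirDeriv v (fun _ => 0) = fun _ => 0 := by
  funext p; simp [dirDeriv]

lemma dirDeriv_add (v : Spacetime → Spacetime) (hU : IsOpen U)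
    (hf : ContDiffOn ℝ ∞ f (futureRegion ∩ U)) (hg : ContDiffOn ℝ ∞ g (futureRegion ∩ U))
    (hp : p ∈ futureRegion ∩ U) :
    dirDeriv v (fun q => f q + g q) p = dirDeriv v f p + dirDeriv v g p := by
  have := (hasFDerivWithinAt_future hU hf hp).add (hasFDerivWithinAt_future hU hg hp)
  simp only [dirDeriv]
  rw [show (fun q => f q + g q) = f + g from rfl,
    this.fderivWithin (uniqueDiffOn_futureRegion p hp.1)]
  rfl

lemma dirDeriv_sub (v : Spacetime → Spacetime) (hU : IsOpen U)
    (hf : ContDiffOn ℝ ∞ f (futureRegion ∩ U)) (hg : ContDiffOn ℝ ∞ g (futureRegion ∩ U))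
    (hp : p ∈ futureRegion ∩ U) :
    dirDeriv v (fun q => f q - g q) p = dirDeriv v f p - dirDeriv v g p := by
  have := (hasFDerivWithinAt_future hU hf hp).sub (hasFDerivWithinAt_future hU hg hp)
  simp only [dirDeriv]
  rw [show (fun q => f q - g q) = f - g from rfl,
    this.fderivWithin (uniqueDiffOn_futureRegion p hp.1)]
  rfl

lemma dirDeriv_mul (v : Spacetime → Spacetime) (hU : IsOpen U)
    (hf : ContDiffOn ℝ ∞ f (futureRegion ∩ U)) (hg : ContDiffOn ℝ ∞ g (futureRegion ∩ U))
    (hp : p ∈ futureRegion ∩ U) :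
    dirDeriv v (fun q => f q * g q) p = dirDeriv v f p * g p + f p * dirDeriv v g p := by
  have := (hasFDerivWithinAt_future hU hf hp).mul (hasFDerivWithinAt_future hU hg hp)
  simp only [dirDeriv]
  rw [show (fun q => f q * g q) = f * g from rfl,
    this.fderivWithin (uniqueDiffOn_futureRegion p hp.1)]
  simp
  ring

lemma cDeriv_add (e : Spacetime) (hU : IsOpen U)
    (hf : ContDiffOn ℝ ∞ f (futureRegion ∩ U)) (hg : ContDiffOn ℝ ∞ g (futureRegion ∩ U))
    (hp : p ∈ futureRegion ∩ U) :
    cDeriv e (fun q => f q + g q) p = cDeriv e f p + cDeriv e g p :=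
  dirDeriv_add _ hU hf hg hp

lemma cDeriv_sub (e : Spacetime) (hU : IsOpen U)
    (hf : ContDiffOn ℝ ∞ f (futureRegion ∩ U)) (hg : ContDiffOn ℝ ∞ g (futureRegion ∩ U))
    (hp : p ∈ futureRegion ∩ U) :
    cDeriv e (fun q => f q - g q) p = cDeriv e f p - cDeriv e g p :=
  dirDeriv_sub _ hU hf hg hp

lemma cDeriv_mul (e : Spacetime) (hU : IsOpen U)
    (hf : ContDiffOn ℝ ∞ f (futureRegion ∩ U)) (hg : ContDiffOn ℝ ∞ g (futureRegion ∩ U))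
    (hp : p ∈ futureRegion ∩ U) :
    cDeriv e (fun q => f q * g q) p = cDeriv e f p * g p + f p * cDeriv e g p :=
  dirDeriv_mul _ hU hf hg hp

lemma cDeriv_vec_add (a b : Spacetime) (f : Spacetime → ℝ) (p : Spacetime) :
    cDeriv (a + b) f p = cDeriv a f p + cDeriv b f p := map_add _ _ _

lemma cDeriv_vec_sub (a b : Spacetime) (f : Spacetime → ℝ) (p : Spacetime) :
    cDeriv (a - b) f p = cDeriv a f p - cDeriv b f p := map_sub _ _ _

lemma cDeriv_vec_smul (c : ℝ) (a : Spacetime) (f : Spacetime → ℝ) (p : Spacetime) :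
    cDeriv (c • a) f p = c * cDeriv a f p := map_smul _ _ _

lemma cDeriv_vec_zero (f : Spacetime → ℝ) (p : Spacetime) : cDeriv 0 f p = 0 := map_zero _

lemma dirDeriv_eq_cDeriv (v : Spacetime → Spacetime) (f : Spacetime → ℝ) (p : Spacetime) :
    dirDeriv v f p = cDeriv (v p) f p := rfl

lemma cDeriv_dirDeriv_aux (e : Spacetime) {v : Spacetime → Spacetime}
    {A : Spacetime →L[ℝ] Spacetime} (hv : HasFDerivAt v A p) (hU : IsOpen U)
    (hf : ContDiffOn ℝ ∞ f (futureRegion ∩ U)) (hp : p ∈ futureRegion ∩ U) :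
    cDeriv e (dirDeriv v f) p =
      fderivWithin ℝ (fderivWithin ℝ f futureRegion) futureRegion p e (v p)
        + cDeriv (A e) f p := by
  have h1 : HasFDerivWithinAt (fderivWithin ℝ f futureRegion)
      (fderivWithin ℝ (fderivWithin ℝ f futureRegion) futureRegion p) futureRegion p :=
    (((contDiffOn_fderivWithin_future hU hf p hp).mono_of_mem_nhdsWithin
      (inter_mem_nhdsWithin_future hU hp)).differentiableWithinAt (by simp)).hasFDerivWithinAt
  have h2 := h1.clm_apply hv.hasFDerivWithinAt
  have h3 := h2.fderivWithin (uniqueDiffOn_futureRegion p hp.1)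
  change fderivWithin ℝ (fun q => fderivWithin ℝ f futureRegion q (v q)) futureRegion p e = _
  rw [h3]
  simp [cDeriv, dirDeriv, add_comm]

lemma cDeriv_cDeriv_apply (a b : Spacetime) (hU : IsOpen U)
    (hf : ContDiffOn ℝ ∞ f (futureRegion ∩ U)) (hp : p ∈ futureRegion ∩ U) :
    cDeriv a (cDeriv b f) p =
      fderivWithin ℝ (fderivWithin ℝ f futureRegion) futureRegion p a b := by
  have := cDeriv_dirDeriv_aux a (hasFDerivAt_const b p) hU hf hp
  rw [show cDeriv b f = dirDeriv (fun _ => b) f from rfl, this]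
  simp [cDeriv_vec_zero]

/-- Second directional derivatives commute, also on the initial slice. -/
lemma cDeriv_comm (a b : Spacetime) (hU : IsOpen U)
    (hf : ContDiffOn ℝ ∞ f (futureRegion ∩ U)) (hp : p ∈ futureRegion ∩ U) :
    cDeriv a (cDeriv b f) p = cDeriv b (cDeriv a f) p := by
  rw [cDeriv_cDeriv_apply a b hU hf hp, cDeriv_cDeriv_apply b a hU hf hp]
  have h : IsSymmSndFDerivWithinAt ℝ f futureRegion p :=
    (contDiffWithinAt_future hU hf hp).isSymmSndFDerivWithinAt
      (by simpa using (WithTop.coe_le_coe.2 le_top : ((2 : ℕ∞) : WithTop ℕ∞) ≤ ∞))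
      uniqueDiffOn_futureRegion (futureRegion_subset_closure_interior hp.1) hp.1
  exact h a b

/-- Commuting a constant-coefficient derivative past a vector field with affine coefficients. -/
lemma cDeriv_dirDeriv (e : Spacetime) {v : Spacetime → Spacetime}
    {A : Spacetime →L[ℝ] Spacetime} (hv : HasFDerivAt v A p) (hU : IsOpen U)
    (hf : ContDiffOn ℝ ∞ f (futureRegion ∩ U)) (hp : p ∈ futureRegion ∩ U) :
    cDeriv e (dirDeriv v f) p = dirDeriv v (cDeriv e f) p + cDeriv (A e) f p := by
  rw [cDeriv_dirDeriv_aux e hv hU hf hp, dirDeriv_eq_cDeriv v, cDeriv_comm _ _ hU hf hp,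
    cDeriv_cDeriv_apply e (v p) hU hf hp]

lemma cDeriv_cDeriv_dirDeriv (e : Spacetime) {v : Spacetime → Spacetime}
    {A : Spacetime →L[ℝ] Spacetime} (hv : ∀ q, HasFDerivAt v A q) (hU : IsOpen U)
    (hf : ContDiffOn ℝ ∞ f (futureRegion ∩ U)) (hp : p ∈ futureRegion ∩ U) :
    cDeriv e (cDeriv e (dirDeriv v f)) p =
      dirDeriv v (cDeriv e (cDeriv e f)) p + 2 * cDeriv (A e) (cDeriv e f) p := by
  have hvs : ContDiffOn ℝ ∞ v (futureRegion ∩ U) := by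
    have : v = fun q => A q + v 0 := by
      funext q
      have h1 : ∀ q, HasFDerivAt (fun q => v q - A q) (0 : Spacetime →L[ℝ] Spacetime) q :=
        fun q => by simpa using (hv q).fun_sub A.hasFDerivAt
      have h2 := is_const_of_fderiv_eq_zero (𝕜 := ℝ) (f := fun q => v q - A q)
        (fun q => (h1 q).differentiableAt) (fun q => (h1 q).fderiv) q 0
      simp only [map_zero, sub_zero] at h2
      rw [← h2]; abel
    rw [this]
    exact (A.contDiff.add contDiff_const).contDiffOn
  have h1 : Set.EqOn (cDeriv e (dirDeriv v f))
      (fun q => dirDeriv v (cDeriv e f) q + cDeriv (A e) f q) (futureRegion ∩ U) :=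
    fun q hq => cDeriv_dirDeriv e (hv q) hU hf hq
  have hef := contDiffOn_cDeriv e hU hf
  rw [cDeriv_congr e hU h1 hp, cDeriv_add e hU (contDiffOn_dirDeriv hU hvs hef)
    (contDiffOn_cDeriv _ hU hf) hp, cDeriv_dirDeriv e (hv p) hU hef hp,
    cDeriv_comm e (A e) hU hf hp]
  ring

lemma dirDeriv_waveOp (v : Spacetime → Spacetime) (hU : IsOpen U)
    (hf : ContDiffOn ℝ ∞ f (futureRegion ∩ U)) (hp : p ∈ futureRegion ∩ U) :
    dirDeriv v (waveOp f) p = -dirDeriv v (cDeriv eT (cDeriv eT f)) p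
      + ∑ i, dirDeriv v (cDeriv (eX i) (cDeriv (eX i) f)) p := by
  have hs : ∀ e, HasFDerivWithinAt (cDeriv e (cDeriv e f)) _ futureRegion p := fun e =>
    hasFDerivWithinAt_future hU (contDiffOn_cDeriv e hU (contDiffOn_cDeriv e hU hf)) hp
  have := (hs eT).fun_neg.fun_add (HasFDerivWithinAt.fun_sum (u := Finset.univ) fun i _ => hs (eX i))
  change fderivWithin ℝ (fun q => -cDeriv eT (cDeriv eT f) q
    + ∑ i, cDeriv (eX i) (cDeriv (eX i) f) q) futureRegion p (v p) = _
  rw [this.fderivWithin (uniqueDiffOn_futureRegion p hp.1)]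
  simp [dirDeriv]

/-- The commutator of `□` with a vector field whose coefficients are affine. -/
lemma waveOp_dirDeriv {v : Spacetime → Spacetime}
    {A : Spacetime →L[ℝ] Spacetime} (hv : ∀ q, HasFDerivAt v A q) (hU : IsOpen U)
    (hf : ContDiffOn ℝ ∞ f (futureRegion ∩ U)) (hp : p ∈ futureRegion ∩ U) :
    waveOp (dirDeriv v f) p = dirDeriv v (waveOp f) p
      + 2 * (-cDeriv (A eT) (cDeriv eT f) p + ∑ i, cDeriv (A (eX i)) (cDeriv (eX i) f) p) := by
  rw [waveOp_eq, dirDeriv_waveOp v hU hf hp, cDeriv_cDeriv_dirDeriv eT hv hU hf hp]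
  simp only [fun i => cDeriv_cDeriv_dirDeriv (eX i) hv hU hf hp, Finset.sum_add_distrib,
    ← Finset.mul_sum]
  ring

lemma waveOp_mul (hU : IsOpen U)
    (hf : ContDiffOn ℝ ∞ f (futureRegion ∩ U)) (hg : ContDiffOn ℝ ∞ g (futureRegion ∩ U))
    (hp : p ∈ futureRegion ∩ U) :
    waveOp (fun q => f q * g q) p = f p * waveOp g p + waveOp f p * g p
      + 2 * (-(cDeriv eT f p * cDeriv eT g p) + ∑ i, cDeriv (eX i) f p * cDeriv (eX i) g p) := by
  have key : ∀ e, cDeriv e (cDeriv e (fun q => f q * g q)) p =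
      f p * cDeriv e (cDeriv e g) p + cDeriv e (cDeriv e f) p * g p
        + 2 * (cDeriv e f p * cDeriv e g p) := by
    intro e
    have hef := contDiffOn_cDeriv e hU hf
    have heg := contDiffOn_cDeriv e hU hg
    rw [cDeriv_congr e hU (fun q hq => cDeriv_mul e hU hf hg hq) hp,
      cDeriv_add e hU (hef.mul hg) (hf.mul heg) hp, cDeriv_mul e hU hef hg hp,
      cDeriv_mul e hU hf heg hp]
    ring
  simp only [waveOp_eq, key, Fin.sum_univ_three]
  ring

lemma waveOp_sub (hU : IsOpen U)
    (hf : ContDiffOn ℝ ∞ f (futureRegion ∩ U)) (hg : ContDiffOn ℝ ∞ g (futureRegion ∩ U))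
    (hp : p ∈ futureRegion ∩ U) :
    waveOp (fun q => f q - g q) p = waveOp f p - waveOp g p := by
  have key : ∀ e, cDeriv e (cDeriv e (fun q => f q - g q)) p =
      cDeriv e (cDeriv e f) p - cDeriv e (cDeriv e g) p := by
    intro e
    rw [cDeriv_congr e hU (fun q hq => cDeriv_sub e hU hf hg hq) hp,
      cDeriv_sub e hU (contDiffOn_cDeriv e hU hf) (contDiffOn_cDeriv e hU hg) hp]
  simp only [waveOp_eq, key, Fin.sum_univ_three]
  ring

end Local

/-! ### The commuting vector fields -/

/-- The coordinate function `X_i` as a continuous linear functional on spacetime. -/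
noncomputable def coordX (i : Fin 3) : Spacetime →L[ℝ] ℝ :=
  (EuclideanSpace.proj i : Space3 →L[ℝ] ℝ).comp (ContinuousLinearMap.snd ℝ ℝ Space3)

@[simp] lemma coordX_apply (i : Fin 3) (p : Spacetime) : coordX i p = p.2 i := rfl

@[simp] lemma eT_fst : eT.1 = 1 := rfl
@[simp] lemma eT_snd : eT.2 = 0 := rfl
@[simp] lemma eX_fst (i : Fin 3) : (eX i).1 = 0 := rfl
@[simp] lemma eX_snd (i : Fin 3) : (eX i).2 = spaceBasis i := rfl
lemma spaceBasis_apply (i j : Fin 3) : spaceBasis i j = if j = i then 1 else 0 := by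
  simp [spaceBasis]

/-- The linear part of each of the eleven commuting vector fields, whose coefficients are
affine functions on spacetime. -/
noncomputable def gammaLin : GammaIdx → Spacetime →L[ℝ] Spacetime
  | .timeTranslation => 0
  | .translation _ => 0
  | .rotation ij => (coordX ij.1.1).smulRight (eX ij.1.2) - (coordX ij.1.2).smulRight (eX ij.1.1)
  | .boost i => (coordX i).smulRight eT + (ContinuousLinearMap.fst ℝ ℝ Space3).smulRight (eX i)
  | .dilation => ContinuousLinearMap.id ℝ Spacetime

lemma hasFDerivAt_gammaVec (q : GammaIdx) (p : Spacetime) :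
    HasFDerivAt (gammaVec q) (gammaLin q) p := by
  cases q with
  | timeTranslation => exact hasFDerivAt_const _ _
  | translation i => exact hasFDerivAt_const _ _
  | rotation ij => exact (gammaLin (.rotation ij)).hasFDerivAt
  | boost i => exact (gammaLin (.boost i)).hasFDerivAt
  | dilation => exact (gammaLin .dilation).hasFDerivAt

lemma contDiff_gammaVec (q : GammaIdx) : ContDiff ℝ ∞ (gammaVec q) := by
  cases q with
  | timeTranslation => exact contDiff_const
  | translation i => exact contDiff_const
  | rotation ij => exact (gammaLin (.rotation ij)).contDiff
  | boost i => exact (gammaLin (.boost i)).contDiff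
  | dilation => exact (gammaLin .dilation).contDiff

lemma IsGoodSolution.contDiffOn_univ {f : Spacetime → ℝ} (hf : IsGoodSolution f) :
    ContDiffOn ℝ ∞ f (futureRegion ∩ Set.univ) := by
  simpa using hf.smooth

lemma mem_future_univ {p : Spacetime} (hp : p ∈ futureRegion) :
    p ∈ futureRegion ∩ Set.univ := ⟨hp, trivial⟩

/-- Each of the eleven fields maps solutions of the wave equation to solutions: the commutator
with `□` vanishes, except for the dilation where it is `2□`. -/
lemma IsGoodSolution.gamma {f : Spacetime → ℝ} (hf : IsGoodSolution f) (q : GammaIdx) :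
    IsGoodSolution (dirDeriv (gammaVec q) f) := by
  have hU := isOpen_univ (X := Spacetime)
  have hs := contDiffOn_dirDeriv hU (contDiff_gammaVec q).contDiffOn hf.contDiffOn_univ
  refine ⟨by simpa using hs, fun p hp => ?_⟩
  have hp' := mem_future_univ hp
  have h0 : dirDeriv (gammaVec q) (waveOp f) p = 0 := by
    rw [dirDeriv_congr (g := fun _ => 0) _ hU (fun x hx => hf.eqn x hx.1) hp', dirDeriv_zero_fun]
  rw [waveOp_dirDeriv (hasFDerivAt_gammaVec q) hU hf.contDiffOn_univ hp', h0, zero_add]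
  have hw := hf.eqn p hp
  have hc := fun a b => cDeriv_comm a b hU hf.contDiffOn_univ hp'
  cases q with
  | timeTranslation => simp [gammaLin, cDeriv_vec_zero]
  | translation i => simp [gammaLin, cDeriv_vec_zero]
  | rotation ij =>
    simp only [gammaLin, sub_apply, ContinuousLinearMap.smulRight_apply,
      cDeriv_vec_sub, cDeriv_vec_smul, coordX_apply, eT_snd, eX_snd, spaceBasis_apply,
      Finset.sum_sub_distrib, ite_mul, one_mul, zero_mul, Finset.sum_ite_eq, Finset.mem_univ,
      if_true]
    rw [hc (eX ij.1.2) (eX ij.1.1)]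
    simp
  | boost i =>
    simp only [gammaLin, add_apply, ContinuousLinearMap.smulRight_apply,
      cDeriv_vec_add, cDeriv_vec_smul, coordX_apply, eT_snd, eX_snd, spaceBasis_apply,
      ContinuousLinearMap.coe_fst', eT_fst, eX_fst,
      Finset.sum_add_distrib, ite_mul, one_mul, zero_mul, Finset.sum_ite_eq, Finset.mem_univ,
      if_true]
    rw [hc (eX i)]
    simp
  | dilation =>
    simp only [gammaLin, ContinuousLinearMap.coe_id', id]
    rw [waveOp_eq] at hw
    rw [hw, mul_zero]

lemma gammaPow_cons (q : GammaIdx) (I : List GammaIdx) (f : Spacetime → ℝ) :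
    gammaPow (q :: I) f = dirDeriv (gammaVec q) (gammaPow I f) := rfl

lemma IsGoodSolution.gammaPow {f : Spacetime → ℝ} (hf : IsGoodSolution f) (I : List GammaIdx) :
    IsGoodSolution (gammaPow I f) := by
  induction I with
  | nil => exact hf
  | cons q I ih => exact ih.gamma q

/-- `Γ^I` does not enlarge the support. -/
lemma gammaPow_eqOn_zero {U : Set Spacetime} {f : Spacetime → ℝ} (hU : IsOpen U)
    (h : ∀ p ∈ futureRegion ∩ U, f p = 0) (I : List GammaIdx) :
    ∀ p ∈ futureRegion ∩ U, gammaPow I f p = 0 := by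
  induction I with
  | nil => exact h
  | cons q I ih =>
    intro p hp
    rw [gammaPow_cons, dirDeriv_congr (g := fun _ => 0) _ hU ih hp, dirDeriv_zero_fun]

/-! ### The ugly equation -/

/-- The complement of the axis `R = 0`. -/
def offAxis : Set Spacetime := {p | p.2 ≠ 0}

lemma isOpen_offAxis : IsOpen offAxis := isOpen_ne_fun continuous_snd continuous_const

/-- The radial coordinate `R` as a function on spacetime. -/
noncomputable def radius : Spacetime → ℝ := fun p => ‖p.2‖

lemma contDiffAt_radius {p : Spacetime} (hp : p ∈ offAxis) : ContDiffAt ℝ ∞ radius p :=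
  contDiffAt_snd.norm ℝ hp

lemma contDiffOn_radius : ContDiffOn ℝ ∞ radius (futureRegion ∩ offAxis) :=
  fun _ hp => (contDiffAt_radius hp.2).contDiffWithinAt

lemma contDiffOn_radius_inv :
    ContDiffOn ℝ ∞ (fun p => (radius p)⁻¹) (futureRegion ∩ offAxis) :=
  contDiffOn_radius.inv fun _ hp => norm_ne_zero_iff.2 hp.2

lemma contDiffOn_coordX (i : Fin 3) (s : Set Spacetime) : ContDiffOn ℝ ∞ (fun p => coordX i p) s :=
  (coordX i).contDiff.contDiffOn

lemma cDeriv_coordX (e : Spacetime) (i : Fin 3) {p : Spacetime} (hp : p ∈ futureRegion) :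
    cDeriv e (fun p => coordX i p) p = e.2 i := by
  simp only [cDeriv, dirDeriv]
  rw [((coordX i).hasFDerivWithinAt).fderivWithin (uniqueDiffOn_futureRegion p hp)]
  rfl

lemma cDeriv_const (e : Spacetime) (c : ℝ) (p : Spacetime) : cDeriv e (fun _ => c) p = 0 := by
  simp [cDeriv, dirDeriv]

/-- `R · ∂_e R = ⟨X, e⟩`, from differentiating `R² = ∑ X_i²`. -/
lemma cDeriv_radius (e : Spacetime) {p : Spacetime} (hp : p ∈ futureRegion ∩ offAxis) :
    cDeriv e radius p = (∑ i, p.2 i * e.2 i) * (radius p)⁻¹ := by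
  have hU := isOpen_offAxis
  have hR : radius p ≠ 0 := norm_ne_zero_iff.2 hp.2
  have h1 : cDeriv e (fun q => radius q * radius q) p = 2 * (radius p * cDeriv e radius p) := by
    rw [cDeriv_mul e hU contDiffOn_radius contDiffOn_radius hp]; ring
  have h2 : (fun q => radius q * radius q) = fun q : Spacetime =>
      (coordX 0 q * coordX 0 q + coordX 1 q * coordX 1 q) + coordX 2 q * coordX 2 q := by
    funext q
    simp only [radius, coordX_apply]
    rw [← sq, EuclideanSpace.norm_sq_eq, Fin.sum_univ_three]
    simp only [Real.norm_eq_abs, sq_abs]; ring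
  have hc := fun i => contDiffOn_coordX i (futureRegion ∩ offAxis)
  rw [h2, cDeriv_add e hU (((hc 0).mul (hc 0)).add ((hc 1).mul (hc 1))) ((hc 2).mul (hc 2)) hp,
    cDeriv_add e hU ((hc 0).mul (hc 0)) ((hc 1).mul (hc 1)) hp, cDeriv_mul e hU (hc 0) (hc 0) hp,
    cDeriv_mul e hU (hc 1) (hc 1) hp, cDeriv_mul e hU (hc 2) (hc 2) hp] at h1
  simp only [cDeriv_coordX e _ hp.1] at h1
  simp only [coordX_apply] at h1
  rw [Fin.sum_univ_three]
  field_simp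
  linarith

lemma cDeriv_eT_radius {p : Spacetime} (hp : p ∈ futureRegion ∩ offAxis) :
    cDeriv eT radius p = 0 := by
  simp [cDeriv_radius eT hp]

lemma cDeriv_eX_radius (i : Fin 3) {p : Spacetime} (hp : p ∈ futureRegion ∩ offAxis) :
    cDeriv (eX i) radius p = p.2 i * (radius p)⁻¹ := by
  rw [cDeriv_radius _ hp]
  simp [spaceBasis_apply]

lemma cDeriv_radius_inv (e : Spacetime) {p : Spacetime} (hp : p ∈ futureRegion ∩ offAxis) :
    cDeriv e (fun q => (radius q)⁻¹) p = -(cDeriv e radius p * ((radius p)⁻¹ * (radius p)⁻¹)) := by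
  have hU := isOpen_offAxis
  have hR : radius p ≠ 0 := norm_ne_zero_iff.2 hp.2
  have h1 := cDeriv_mul e hU contDiffOn_radius contDiffOn_radius_inv hp
  have h2 : Set.EqOn (fun q => radius q * (radius q)⁻¹) (fun _ => 1) (futureRegion ∩ offAxis) :=
    fun q hq => mul_inv_cancel₀ (norm_ne_zero_iff.2 hq.2)
  rw [cDeriv_congr e hU h2 hp, cDeriv_const] at h1
  field_simp
  field_simp at h1
  linarith

lemma sum_sq_eq_radius (p : Spacetime) : ∑ i, p.2 i * p.2 i = radius p * radius p := by
  simp only [radius]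
  rw [← sq, EuclideanSpace.norm_sq_eq]
  simp [sq]

lemma waveOp_radius {p : Spacetime} (hp : p ∈ futureRegion ∩ offAxis) :
    waveOp radius p = 2 * (radius p)⁻¹ := by
  have hU := isOpen_offAxis
  have hR : radius p ≠ 0 := norm_ne_zero_iff.2 hp.2
  have hT : cDeriv eT (cDeriv eT radius) p = 0 := by
    rw [cDeriv_congr (g := fun _ => 0) eT hU (fun q hq => cDeriv_eT_radius hq) hp, cDeriv_const]
  have hX : ∀ i, cDeriv (eX i) (cDeriv (eX i) radius) p = (radius p)⁻¹
      - p.2 i * p.2 i * ((radius p)⁻¹ * (radius p)⁻¹ * (radius p)⁻¹) := by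
    intro i
    rw [cDeriv_congr (g := fun q => coordX i q * (radius q)⁻¹) (eX i) hU
      (fun q hq => cDeriv_eX_radius i hq) hp, cDeriv_mul _ hU (contDiffOn_coordX i _)
      contDiffOn_radius_inv hp, cDeriv_coordX _ _ hp.1, cDeriv_radius_inv _ hp,
      cDeriv_eX_radius i hp]
    simp [spaceBasis_apply]
    ring
  rw [waveOp_eq, hT]
  simp only [hX, Finset.sum_sub_distrib, ← Finset.sum_mul, sum_sq_eq_radius]
  simp
  field_simp
  ring

/-- The scaling vector field `X^i ∂_i` of space. -/
noncomputable def spaceScaling : Spacetime →L[ℝ] Spacetime :=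
  (ContinuousLinearMap.inr ℝ ℝ Space3).comp (ContinuousLinearMap.snd ℝ ℝ Space3)

@[simp] lemma spaceScaling_apply (p : Spacetime) : spaceScaling p = (0, p.2) := rfl

lemma spaceScaling_eq_sum (p : Spacetime) : spaceScaling p = ∑ i, p.2 i • eX i := by
  ext j
  · simp [Prod.fst_sum]
  · fin_cases j <;> simp [spaceBasis_apply, Fin.sum_univ_three]

lemma cDeriv_spaceScaling (f : Spacetime → ℝ) (p : Spacetime) :
    dirDeriv spaceScaling f p = ∑ i, p.2 i * cDeriv (eX i) f p := by
  rw [dirDeriv_eq_cDeriv, spaceScaling_eq_sum, Fin.sum_univ_three, Fin.sum_univ_three,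
    cDeriv_vec_add, cDeriv_vec_add]
  simp only [cDeriv_vec_smul]

lemma dirDeriv_vecPsiBar (φ : Spacetime → ℝ) (p : Spacetime) :
    dirDeriv vecPsiBar φ p = cDeriv eT φ p - (radius p)⁻¹ * dirDeriv spaceScaling φ p := by
  rw [dirDeriv_eq_cDeriv, dirDeriv_eq_cDeriv, ← cDeriv_vec_smul, ← cDeriv_vec_sub]
  congr 1
  simp [vecPsiBar, eT, radius]

/-- Off the axis `R ∇_ψ̄ φ = R ∂_T φ - X^i ∂_i φ`. -/
lemma rescaledPsiBar_eq (φ : Spacetime → ℝ) {p : Spacetime} (hp : p ∈ offAxis) :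
    rescaledPsiBar φ p = radius p * cDeriv eT φ p - dirDeriv spaceScaling φ p := by
  have hR : radius p ≠ 0 := norm_ne_zero_iff.2 hp
  rw [rescaledPsiBar, dirDeriv_vecPsiBar]
  change radius p * _ = _
  field_simp

section Ugly

variable {φ : Spacetime → ℝ} {p : Spacetime}

lemma IsUglySolution.contDiffOn_inter (h : IsUglySolution 1 (fun _ => 0) φ) :
    ContDiffOn ℝ ∞ φ (futureRegion ∩ offAxis) := h.smooth

lemma IsUglySolution.waveOp_eq (h : IsUglySolution 1 (fun _ => 0) φ)
    (hp : p ∈ futureRegion ∩ offAxis) :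
    waveOp φ p = 2 * ((radius p)⁻¹ * cDeriv eT φ p) := by
  rw [h.eqn p hp, dirDeriv_vecT]
  simp [radius]
  ring

/-- Off the axis the rescaled derivative of an ugly field solves the wave equation: `□` commutes
with `R ∂_T - X^i ∂_i` up to `(2/R)(1 + X^i ∂_i) ∂_T - 2Δ`, which the ugly equation turns into
a cancellation. -/
lemma IsUglySolution.waveOp_rescaledPsiBar_offAxis (h : IsUglySolution 1 (fun _ => 0) φ)
    (hp : p ∈ futureRegion ∩ offAxis) : waveOp (rescaledPsiBar φ) p = 0 := by
  have hU := isOpen_offAxis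
  have hs := h.contDiffOn_inter
  have hTs := contDiffOn_cDeriv eT hU hs
  have hR : radius p ≠ 0 := norm_ne_zero_iff.2 hp.2
  have hS : ContDiffOn ℝ ∞ (dirDeriv spaceScaling φ) (futureRegion ∩ offAxis) :=
    contDiffOn_dirDeriv hU spaceScaling.contDiff.contDiffOn hs
  -- the two sides of the equation differentiated along `∂_T` and along `X^i ∂_i`
  have hwT : waveOp (cDeriv eT φ) p = 2 * ((radius p)⁻¹ * cDeriv eT (cDeriv eT φ) p) := by
    have h1 := waveOp_dirDeriv (fun q => hasFDerivAt_const eT q) hU hs hp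
    simp only [zero_apply, cDeriv_vec_zero, neg_zero, Finset.sum_const_zero,
      add_zero, mul_zero] at h1
    change waveOp (cDeriv eT φ) p = cDeriv eT (waveOp φ) p at h1
    rw [h1, cDeriv_congr eT hU (fun q hq => h.waveOp_eq hq) hp,
      cDeriv_mul eT hU contDiffOn_const (contDiffOn_radius_inv.mul hTs) hp,
      cDeriv_mul eT hU contDiffOn_radius_inv hTs hp, cDeriv_radius_inv eT hp, cDeriv_eT_radius hp,
      cDeriv_const]
    ring
  have hSw : dirDeriv spaceScaling (waveOp φ) p = 2 * (-((radius p)⁻¹ * cDeriv eT φ p)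
      + (radius p)⁻¹ * dirDeriv spaceScaling (cDeriv eT φ) p) := by
    have hSR : cDeriv (spaceScaling p) radius p = radius p := by
      rw [cDeriv_radius _ hp]
      simp only [spaceScaling_apply, sum_sq_eq_radius]
      field_simp
    simp only [dirDeriv_eq_cDeriv]
    rw [cDeriv_congr _ hU (fun q hq => h.waveOp_eq hq) hp,
      cDeriv_mul _ hU contDiffOn_const (contDiffOn_radius_inv.mul hTs) hp,
      cDeriv_mul _ hU contDiffOn_radius_inv hTs hp, cDeriv_radius_inv _ hp, hSR, cDeriv_const]
    field_simp
    ring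
  have hwS := waveOp_dirDeriv (fun q => spaceScaling.hasFDerivAt (x := q)) hU hs hp
  have hAT : spaceScaling eT = 0 := by simp
  have hAX : ∀ i, spaceScaling (eX i) = eX i := fun i => rfl
  rw [hAT] at hwS
  simp only [hAX, cDeriv_vec_zero] at hwS
  have hw := h.waveOp_eq hp
  rw [_root_.waveOp_eq] at hw
  have hSdT := cDeriv_spaceScaling (cDeriv eT φ) p
  rw [waveOp_congr hU (fun q hq => rescaledPsiBar_eq φ hq.2) hp,
    waveOp_sub hU (contDiffOn_radius.mul hTs) hS hp, waveOp_mul hU contDiffOn_radius hTs hp,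
    hwT, waveOp_radius hp, hwS, hSw, cDeriv_eT_radius hp]
  simp only [cDeriv_eX_radius _ hp, Fin.sum_univ_three] at hw hSdT ⊢
  rw [hSdT]
  have e1 : ∀ a : ℝ, radius p * (2 * ((radius p)⁻¹ * a)) = 2 * a := fun a => by field_simp
  rw [e1]
  linear_combination -2 * hw

/-- By continuity the wave equation extends across the axis. -/
lemma IsUglySolution.isGoodSolution_rescaledPsiBar (h : IsUglySolution 1 (fun _ => 0) φ)
    (hs : ContDiffOn ℝ ∞ (rescaledPsiBar φ) futureRegion) :
    IsGoodSolution (rescaledPsiBar φ) := by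
  refine ⟨hs, fun p hp => ?_⟩
  by_cases hp2 : p.2 = 0
  swap
  · exact h.waveOp_rescaledPsiBar_offAxis ⟨hp, hp2⟩
  have hcont : ContinuousOn (waveOp (rescaledPsiBar φ)) futureRegion := by
    have := contDiffOn_waveOp isOpen_univ (f := rescaledPsiBar φ) (by simpa using hs)
    simpa using this.continuousOn
  -- approach the axis along the line `t ↦ p + t e₁`
  have hpath : Tendsto (fun t : ℝ => p + t • eX 0) (𝓝[>] 0) (𝓝[futureRegion] p) := by
    refine tendsto_nhdsWithin_iff.2 ⟨?_, Eventually.of_forall fun t => ?_⟩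
    · have : Continuous fun t : ℝ => p + t • eX 0 := by fun_prop
      simpa using (this.tendsto 0).mono_left nhdsWithin_le_nhds
    · simpa [futureRegion] using hp
  have h1 : Tendsto (fun t : ℝ => waveOp (rescaledPsiBar φ) (p + t • eX 0)) (𝓝[>] 0)
      (𝓝 (waveOp (rescaledPsiBar φ) p)) := (hcont p hp).tendsto.comp hpath
  refine tendsto_nhds_unique (h1.congr' ?_) tendsto_const_nhds
  filter_upwards [self_mem_nhdsWithin] with t ht
  refine h.waveOp_rescaledPsiBar_offAxis ⟨?_, ?_⟩
  · simpa [futureRegion] using hp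
  · simp only [offAxis, Set.mem_ofPred_eq, Prod.snd_add, hp2, Prod.smul_snd, eX_snd, zero_add]
    exact smul_ne_zero (ne_of_gt ht) (by simp [spaceBasis])

end Ugly

/-! ### Restriction to slices of constant time and the initial data -/

/-- The derivative of a slice is the spatial part of the spacetime derivative. -/
lemma hasFDerivAt_slice {U : Set Spacetime} {f : Spacetime → ℝ} {T : ℝ} {X : Space3}
    (hU : IsOpen U) (hf : ContDiffOn ℝ ∞ f (futureRegion ∩ U)) (hp : (T, X) ∈ futureRegion ∩ U) :
    HasFDerivAt (fun Y : Space3 => f (T, Y))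
      ((fderivWithin ℝ f futureRegion (T, X)).comp (ContinuousLinearMap.inr ℝ ℝ Space3)) X := by
  have h1 : HasFDerivAt (fun Y : Space3 => ((T, Y) : Spacetime))
      (ContinuousLinearMap.inr ℝ ℝ Space3) X := hasFDerivAt_prodMk_right T X
  exact (hasFDerivWithinAt_future hU hf hp).comp_hasFDerivAt X h1
    (Eventually.of_forall fun Y => hp.1)

lemma cDeriv_eX_eq_zero_of_slice {U : Set Spacetime} {f : Spacetime → ℝ} {ρ T : ℝ} {X : Space3}
    (hU : IsOpen U) (hf : ContDiffOn ℝ ∞ f (futureRegion ∩ U)) (hp : (T, X) ∈ futureRegion ∩ U)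
    (h0 : ∀ Y : Space3, ρ < ‖Y‖ → f (T, Y) = 0) (hX : ρ < ‖X‖) (i : Fin 3) :
    cDeriv (eX i) f (T, X) = 0 := by
  have h1 := hasFDerivAt_slice hU hf hp
  have h2 : (fun Y : Space3 => f (T, Y)) =ᶠ[𝓝 X] fun _ => 0 := by
    filter_upwards [(isOpen_lt continuous_const continuous_norm).mem_nhds hX] with Y hY
      using h0 Y hY
  have h3 := (h1.congr_of_eventuallyEq h2.symm).unique (hasFDerivAt_const (0 : ℝ) X)
  exact congrArg (fun L : Space3 →L[ℝ] ℝ => L (spaceBasis i)) h3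

/-- The data of `R ∇_ψ̄ φ` are supported where those of `φ` are; the second time derivative of `φ`
entering `∂_T (R ∇_ψ̄ φ)` is expressed through the data by the ugly equation. -/
lemma IsUglySolution.dataSupportedIn_rescaledPsiBar {φ : Spacetime → ℝ} {ρ : ℝ}
    (h : IsUglySolution 1 (fun _ => 0) φ) (hρ : 0 ≤ ρ) (hd : DataSupportedIn ρ φ) :
    DataSupportedIn ρ (rescaledPsiBar φ) := by
  have hU := isOpen_offAxis
  have hs := h.contDiffOn_inter
  have hTs := contDiffOn_cDeriv eT hU hs
  have hmem : ∀ Y : Space3, ρ < ‖Y‖ → ((0, Y) : Spacetime) ∈ futureRegion ∩ offAxis :=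
    fun Y hY => ⟨le_refl (0 : ℝ), norm_pos_iff.1 (hρ.trans_lt hY)⟩
  have hT : ∀ Y : Space3, ρ < ‖Y‖ → cDeriv eT φ (0, Y) = 0 := fun Y hY => (hd Y hY).2
  have hX : ∀ i, ∀ Y : Space3, ρ < ‖Y‖ → cDeriv (eX i) φ (0, Y) = 0 := fun i Y hY =>
    cDeriv_eX_eq_zero_of_slice hU hs (hmem Y hY) (fun Z hZ => (hd Z hZ).1) hY i
  intro X hX0
  have hp := hmem X hX0
  constructor
  · rw [rescaledPsiBar_eq φ hp.2, hT X hX0, cDeriv_spaceScaling]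
    simp [hX _ X hX0]
  · have hTT : cDeriv eT (cDeriv eT φ) (0, X) = 0 := by
      have hw := h.waveOp_eq hp
      rw [_root_.waveOp_eq, hT X hX0] at hw
      simp only [fun i => cDeriv_eX_eq_zero_of_slice hU (contDiffOn_cDeriv (eX i) hU hs) hp
        (hX i) hX0 i] at hw
      simpa using hw
    have hSs : ContDiffOn ℝ ∞ (dirDeriv spaceScaling φ) (futureRegion ∩ offAxis) :=
      contDiffOn_dirDeriv hU spaceScaling.contDiff.contDiffOn hs
    have hAT : spaceScaling eT = 0 := by simp
    rw [dirDeriv_vecT, cDeriv_congr eT hU (fun q hq => rescaledPsiBar_eq φ hq.2) hp,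
      cDeriv_sub eT hU (contDiffOn_radius.mul hTs) hSs hp, cDeriv_mul eT hU contDiffOn_radius hTs hp,
      cDeriv_eT_radius hp, hTT,
      cDeriv_dirDeriv eT (spaceScaling.hasFDerivAt (x := ((0, X) : Spacetime))) hU hs hp, hAT,
      cDeriv_vec_zero, cDeriv_spaceScaling]
    simp [fun i => cDeriv_eX_eq_zero_of_slice hU hTs hp hT hX0 i]

lemma DataSupportedIn.mono {ρ σ : ℝ} {f : Spacetime → ℝ} (h : DataSupportedIn ρ f) (hρ : ρ ≤ σ) :
    DataSupportedIn σ f := fun X hX => h X (hρ.trans_lt hX)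

/-! ### Integrals over the unit sphere -/

/-- If `∂_s G` has vanishing integral for every `s` between `a` and `b`, then `∫ G b = ∫ G a`.
Fubini replaces differentiation under the integral, so nothing is asked of the derivative at the
endpoints beyond continuity. -/
lemma integral_eq_of_integral_deriv_eq_zero {α : Type*} [TopologicalSpace α] [T2Space α]
    [SecondCountableTopology α] [MeasurableSpace α] [BorelSpace α] (μ : Measure α) [SFinite μ]
    [IsFiniteMeasureOnCompacts μ] {a b : ℝ} (hab : a ≤ b) {G G' : ℝ → α → ℝ} {K : Set α}
    (hK : IsCompact K)
    (hG' : ContinuousOn (Function.uncurry G') (Set.Icc a b ×ˢ Set.univ))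
    (hsupp : ∀ s ∈ Set.Icc a b, ∀ x ∉ K, G' s x = 0)
    (hG : ∀ x, ContinuousOn (fun s => G s x) (Set.Icc a b))
    (hder : ∀ x, ∀ s ∈ Set.Ioo a b, HasDerivAt (fun s => G s x) (G' s x) s)
    (h0 : ∀ s ∈ Set.Ioo a b, ∫ x, G' s x ∂μ = 0)
    (hGa : Integrable (G a) μ) (hGb : Integrable (G b) μ) :
    ∫ x, G b x ∂μ = ∫ x, G a x ∂μ := by
  have hint : Integrable (Function.uncurry G') ((volume.restrict (Set.uIoc a b)).prod μ) := by
    rw [Set.uIoc_of_le hab]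
    have h1 : IntegrableOn (Function.uncurry G') (Set.Icc a b ×ˢ K) (volume.prod μ) :=
      (hG'.mono (Set.prod_mono_right (Set.subset_univ K))).integrableOn_compact
        (isCompact_Icc.prod hK)
    have h2 : IntegrableOn (Function.uncurry G') (Set.Icc a b ×ˢ Set.univ) (volume.prod μ) := by
      refine h1.of_forall_sdiff_eq_zero (measurableSet_Icc.prod .univ) ?_
      rintro ⟨s, x⟩ ⟨⟨hs, -⟩, hx⟩
      exact hsupp s hs x fun hxK => hx ⟨hs, hxK⟩
    have h3 := h2.mono_set (Set.prod_mono_left Set.Ioc_subset_Icc_self)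
    rwa [IntegrableOn, ← Measure.prod_restrict, Measure.restrict_univ] at h3
  have hswap := intervalIntegral_integral_swap hint
  have hleft : ∫ s in a..b, ∫ x, G' s x ∂μ = 0 := by
    rw [intervalIntegral.integral_of_le hab, integral_Ioc_eq_integral_Ioo]
    exact setIntegral_eq_zero_of_forall_eq_zero h0
  have hright : ∀ x, ∫ s in a..b, G' s x = G b x - G a x := by
    intro x
    refine intervalIntegral.integral_eq_sub_of_hasDerivAt_of_le hab (hG x) (hder x) ?_
    refine ContinuousOn.intervalIntegrable ?_
    rw [Set.uIcc_of_le hab]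
    exact hG'.comp (f := fun s => (s, x)) (by fun_prop) fun s hs => ⟨hs, trivial⟩
  rw [hleft] at hswap
  simp only [hright] at hswap
  rw [integral_sub hGb hGa] at hswap
  linarith

/-- The unit sphere of space. -/
abbrev Sphere2 : Type := Metric.sphere (0 : Space3) 1

/-- The surface measure of the unit sphere. -/
noncomputable def sphereMeasure : Measure Sphere2 := (volume : Measure Space3).toSphere

instance instIsFiniteMeasureSphere : IsFiniteMeasure sphereMeasure :=
  inferInstanceAs (IsFiniteMeasure (volume : Measure Space3).toSphere)

lemma norm_sphere (w : Sphere2) : ‖(w : Space3)‖ = 1 := by simp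

lemma sum_sq_sphere (w : Sphere2) : (w : Space3) 0 ^ 2 + (w : Space3) 1 ^ 2
    + (w : Space3) 2 ^ 2 = 1 := by
  have := EuclideanSpace.norm_sq_eq (w : Space3)
  rw [norm_sphere, Fin.sum_univ_three] at this
  simpa using this.symm

lemma integrable_sphere {k : Sphere2 → ℝ} (hk : Continuous k) : Integrable k sphereMeasure :=
  hk.integrable_of_hasCompactSupport (HasCompactSupport.of_compactSpace k)

/-- The action of a linear isometry on the unit sphere. -/
noncomputable def sphereMap (L : Space3 ≃ₗᵢ[ℝ] Space3) (w : Sphere2) : Sphere2 :=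
  ⟨L w, by simp⟩

lemma continuous_sphereMap (L : Space3 ≃ₗᵢ[ℝ] Space3) : Continuous (sphereMap L) :=
  (L.continuous.comp continuous_subtype_val).subtype_mk _

open scoped Pointwise in
lemma map_sphereMap (L : Space3 ≃ₗᵢ[ℝ] Space3) : sphereMeasure.map (sphereMap L) = sphereMeasure := by
  ext s hs
  have hm := (continuous_sphereMap L).measurable
  rw [Measure.map_apply hm hs, sphereMeasure, Measure.toSphere_apply' _ (hm hs),
    Measure.toSphere_apply' _ hs]
  congr 1
  have : Set.Ioo (0 : ℝ) 1 • ((↑) '' (sphereMap L ⁻¹' s) : Set Space3)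
      = L ⁻¹' (Set.Ioo (0 : ℝ) 1 • ((↑) '' s : Set Space3)) := by
    ext y
    simp only [Set.mem_smul, Set.mem_image, Set.mem_preimage]
    constructor
    · rintro ⟨r, hr, _, ⟨w, hw, rfl⟩, rfl⟩
      exact ⟨r, hr, _, ⟨sphereMap L w, hw, rfl⟩, by simp [sphereMap]⟩
    · rintro ⟨r, hr, _, ⟨w, hw, rfl⟩, h⟩
      refine ⟨r, hr, _, ⟨sphereMap L.symm w, ?_, rfl⟩, ?_⟩
      · have : sphereMap L (sphereMap L.symm w) = w := by ext1; simp [sphereMap]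
        rwa [this]
      · apply L.injective
        rw [← h]
        simp [sphereMap]
  rw [this]
  exact L.measurePreserving.measure_preimage_equiv (f := L.toHomeomorph.toMeasurableEquiv) _

lemma integral_sphereMap (L : Space3 ≃ₗᵢ[ℝ] Space3) {k : Sphere2 → ℝ} (hk : Continuous k) :
    ∫ w, k (sphereMap L w) ∂sphereMeasure = ∫ w, k w ∂sphereMeasure := by
  conv_rhs => rw [← map_sphereMap L]
  rw [integral_map (continuous_sphereMap L).aemeasurable hk.aestronglyMeasurable]

/-- Integration in polar coordinates. -/
lemma lintegral_polar {F : Space3 → ENNReal} (hF : Measurable F) :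
    ∫⁻ y, F y = ∫⁻ w : Sphere2, (∫⁻ s in Set.Ioi (0 : ℝ),
      ENNReal.ofReal (s ^ 2) * F (s • (w : Space3))) ∂sphereMeasure := by
  have h1 : ∫⁻ y, F y = ∫⁻ y : ({0}ᶜ : Set Space3), F y ∂(volume.comap Subtype.val) := by
    rw [lintegral_subtype_comap (measurableSet_singleton _).compl,
      restrict_compl_singleton]
  have h2 := (volume : Measure Space3).measurePreserving_homeomorphUnitSphereProd.lintegral_comp_emb
    (Homeomorph.measurableEmbedding _) (fun z => F ((z.2 : ℝ) • (z.1 : Space3)))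
  have h3 : ∀ y : ({0}ᶜ : Set Space3), F (((homeomorphUnitSphereProd Space3 y).2 : ℝ) •
      ((homeomorphUnitSphereProd Space3 y).1 : Space3)) = F y := by
    intro y
    have : ‖(y : Space3)‖ ≠ 0 := norm_ne_zero_iff.2 y.2
    simp [smul_smul, this]
  simp only [h3] at h2
  have hmeas : Measurable fun z : Sphere2 × Set.Ioi (0 : ℝ) => F ((z.2 : ℝ) • (z.1 : Space3)) :=
    hF.comp (by fun_prop)
  rw [h1, h2, lintegral_prod _ hmeas.aemeasurable]
  refine lintegral_congr fun w => ?_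
  have hd : Module.finrank ℝ Space3 - 1 = 2 := by simp
  have hFw : Measurable fun s : Set.Ioi (0 : ℝ) => F ((s : ℝ) • (w : Space3)) :=
    hF.comp (by fun_prop)
  rw [hd, Measure.volumeIoiPow]
  simp only
  rw [lintegral_withDensity_eq_lintegral_mul _ (by fun_prop) hFw,
    ← lintegral_subtype_comap measurableSet_Ioi]
  rfl

/-! ### Rotations and the Laplacian of the sphere -/

section Rotation

variable {B : Space3 →L[ℝ] Space3}

/-- Rodrigues' formula for the rotation `exp (θ B)` generated by a skew map with `B³ = -B`. -/
noncomputable def rodrigues (B : Space3 →L[ℝ] Space3) (θ : ℝ) : Space3 →L[ℝ] Space3 :=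
  ContinuousLinearMap.id ℝ Space3 + Real.sin θ • B + (1 - Real.cos θ) • B.comp B

lemma rodrigues_apply (θ : ℝ) (y : Space3) :
    rodrigues B θ y = y + Real.sin θ • B y + (1 - Real.cos θ) • B (B y) := rfl

lemma norm_rodrigues (hskew : ∀ x y, inner ℝ (B x) y = -inner ℝ x (B y))
    (hcube : ∀ y, B (B (B y)) = -B y) (θ : ℝ) (y : Space3) : ‖rodrigues B θ y‖ = ‖y‖ := by
  have h1 : inner ℝ y (B y) = 0 := by
    have h := hskew y y
    rw [real_inner_comm] at h
    linarith
  have h2 : inner ℝ (B y) (B (B y)) = 0 := by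
    have h := hskew (B y) (B y)
    rw [real_inner_comm] at h
    linarith
  have h3 : inner ℝ y (B (B y)) = -inner ℝ (B y) (B y) := by
    have h := hskew y (B y)
    linarith
  have h4 : inner ℝ (B (B y)) (B (B y)) = inner ℝ (B y) (B y) := by
    rw [hskew, hcube, inner_neg_right, neg_neg]
  have hsq : inner ℝ (rodrigues B θ y) (rodrigues B θ y) = inner ℝ y y := by
    rw [rodrigues_apply]
    simp only [inner_add_left, inner_add_right, real_inner_smul_left, real_inner_smul_right,
      h1, h2, h3, h4, real_inner_comm y (B y), real_inner_comm y (B (B y)),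
      real_inner_comm (B y) (B (B y))]
    linear_combination (inner ℝ (B y) (B y)) * Real.sin_sq_add_cos_sq θ
  rw [real_inner_self_eq_norm_sq, real_inner_self_eq_norm_sq] at hsq
  exact (sq_eq_sq₀ (norm_nonneg _) (norm_nonneg _)).1 hsq

lemma hasDerivAt_rodrigues (hcube : ∀ y, B (B (B y)) = -B y) (θ : ℝ) (y : Space3) :
    HasDerivAt (fun t => rodrigues B t y) (B (rodrigues B θ y)) θ := by
  have h1 := ((Real.hasDerivAt_sin θ).smul_const (B y)).const_add y
  have h2 := ((Real.hasDerivAt_cos θ).const_sub 1).smul_const (B (B y))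
  have h3 := h1.add h2
  refine h3.congr_deriv ?_
  rw [rodrigues_apply]
  simp only [map_add, map_smul, hcube, neg_neg]
  module

/-- The derivative of a function along a rotation field has integral zero over the sphere. -/
lemma integral_rotation_deriv (hskew : ∀ x y, inner ℝ (B x) y = -inner ℝ x (B y))
    (hcube : ∀ y, B (B (B y)) = -B y) {k : Space3 → ℝ} (hk : ContDiff ℝ 1 k) :
    ∫ w : Sphere2, fderiv ℝ k w (B w) ∂sphereMeasure = 0 := by
  let L : ℝ → Space3 ≃ₗᵢ[ℝ] Space3 := fun θ =>
    LinearIsometry.toLinearIsometryEquiv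
      ⟨(rodrigues B θ).toLinearMap, norm_rodrigues hskew hcube θ⟩ rfl
  have hL : ∀ θ y, L θ y = rodrigues B θ y := fun _ _ => rfl
  have hk' : Continuous (fderiv ℝ k) := hk.continuous_fderiv one_ne_zero
  let D : Space3 → ℝ := fun y => fderiv ℝ k y (B y)
  have hD : Continuous D := hk'.clm_apply B.continuous
  have hDs : Continuous fun w : Sphere2 => D w := hD.comp continuous_subtype_val
  have hrod : Continuous fun z : ℝ × Sphere2 => rodrigues B z.1 z.2 := by
    simp only [rodrigues_apply]
    fun_prop
  have hrodw : ∀ θ, Continuous fun w : Sphere2 => rodrigues B θ w := fun θ => by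
    simp only [rodrigues_apply]
    fun_prop
  have hrodθ : ∀ w : Sphere2, Continuous fun θ => rodrigues B θ w := fun w => by
    simp only [rodrigues_apply]
    fun_prop
  have hksph : ∀ θ, Continuous fun w : Sphere2 => k (rodrigues B θ w) := fun θ =>
    hk.continuous.comp (hrodw θ)
  have hG'c : Continuous (Function.uncurry fun (θ : ℝ) (w : Sphere2) =>
      D (rodrigues B θ w) - D w) := (hD.comp hrod).sub (hDs.comp continuous_snd)
  have hGc : ∀ w : Sphere2, Continuous fun θ : ℝ => k (rodrigues B θ w) - θ * D w := fun w =>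
    (hk.continuous.comp (hrodθ w)).sub (continuous_id.mul continuous_const)
  have hder : ∀ (w : Sphere2) (θ : ℝ), HasDerivAt (fun θ => k (rodrigues B θ w) - θ * D w)
      (D (rodrigues B θ w) - D w) θ := fun w θ => by
    have h1 := ((hk.differentiable one_ne_zero) (rodrigues B θ w)).hasFDerivAt.comp_hasDerivAt θ
      (hasDerivAt_rodrigues hcube θ (w : Space3))
    refine (HasDerivAt.fun_sub (f := fun t => k (rodrigues B t w)) h1
      ((hasDerivAt_id θ).mul_const (D w))).congr_deriv ?_
    rw [one_mul]
  have key := integral_eq_of_integral_deriv_eq_zero sphereMeasure (zero_le_one (α := ℝ))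
    (G := fun θ w => k (rodrigues B θ w) - θ * D w)
    (G' := fun θ w => D (rodrigues B θ w) - D w) isCompact_univ
    hG'c.continuousOn (fun _ _ w hw => absurd (Set.mem_univ w) hw)
    (fun w => (hGc w).continuousOn) (fun w θ _ => hder w θ)
    (fun θ _ => by
      rw [integral_sub (f := fun w : Sphere2 => D (rodrigues B θ w))
        (integrable_sphere (hD.comp (hrodw θ))) (integrable_sphere hDs)]
      have := integral_sphereMap (L θ) hDs
      simp only [sphereMap, hL] at this
      rw [this, sub_self])
    (integrable_sphere ((hksph 0).sub (continuous_const.mul hDs)))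
    (integrable_sphere ((hksph 1).sub (continuous_const.mul hDs)))
  simp only [one_mul, zero_mul, sub_zero] at key
  rw [integral_sub (integrable_sphere (hksph 1)) (integrable_sphere hDs)] at key
  have h1 := integral_sphereMap (L 1) (k := fun w => k w) (hk.continuous.comp continuous_subtype_val)
  have h0 := integral_sphereMap (L 0) (k := fun w => k w) (hk.continuous.comp continuous_subtype_val)
  simp only [sphereMap, hL] at h1 h0
  rw [h1, h0] at key
  change ∫ w : Sphere2, D w ∂sphereMeasure = 0
  linarith

end Rotation

/-- The generator `y ↦ y_i e_j - y_j e_i` of the rotations in the `(i, j)` plane. -/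
noncomputable def rotGen (i j : Fin 3) : Space3 →L[ℝ] Space3 :=
  (EuclideanSpace.proj i : Space3 →L[ℝ] ℝ).smulRight (spaceBasis j)
    - (EuclideanSpace.proj j : Space3 →L[ℝ] ℝ).smulRight (spaceBasis i)

lemma rotGen_apply (i j : Fin 3) (y : Space3) :
    rotGen i j y = y i • spaceBasis j - y j • spaceBasis i := rfl

lemma rotGen_skew (i j : Fin 3) (x y : Space3) :
    inner ℝ (rotGen i j x) y = -inner ℝ x (rotGen i j y) := by
  simp only [rotGen_apply, inner_sub_left, inner_sub_right, real_inner_smul_left,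
    real_inner_smul_right, spaceBasis, EuclideanSpace.inner_single_left,
    EuclideanSpace.inner_single_right]
  simp
  ring

lemma rotGen_sq {i j : Fin 3} (hij : i ≠ j) (y : Space3) :
    rotGen i j (rotGen i j y) = -(y i • spaceBasis i) - y j • spaceBasis j := by
  rw [rotGen_apply, rotGen_apply]
  simp [spaceBasis_apply, hij, hij.symm]
  abel

lemma rotGen_cube {i j : Fin 3} (hij : i ≠ j) (y : Space3) :
    rotGen i j (rotGen i j (rotGen i j y)) = -rotGen i j y := by
  rw [rotGen_sq hij, rotGen_apply]
  simp [spaceBasis_apply, hij, hij.symm]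

/-- The operator `|y|² Δ - (y·∇)² - y·∇` restricted to the unit sphere is the sum of the squares
of the rotation fields, that is, the Laplacian of the sphere; its integral vanishes. -/
lemma integral_sphere_laplacian {h : Space3 → ℝ} (hh : ContDiff ℝ ∞ h) :
    ∫ w : Sphere2, (∑ i, fderiv ℝ (fderiv ℝ h) w (spaceBasis i) (spaceBasis i)
      - fderiv ℝ (fderiv ℝ h) w w w - 2 * fderiv ℝ h w w) ∂sphereMeasure = 0 := by
  have hd : ContDiff ℝ ∞ (fderiv ℝ h) := hh.fderiv_right (by simp)
  have hdd : Continuous (fderiv ℝ (fderiv ℝ h)) := hd.continuous_fderiv (by simp)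
  let S : Fin 3 → Fin 3 → Space3 → ℝ := fun i j y =>
    fderiv ℝ (fderiv ℝ h) y (rotGen i j y) (rotGen i j y) + fderiv ℝ h y (rotGen i j (rotGen i j y))
  have hScont : ∀ i j, Continuous fun w : Sphere2 => S i j w := fun i j => by
    refine Continuous.comp (g := S i j) ?_ continuous_subtype_val
    exact ((hdd.clm_apply (rotGen i j).continuous).clm_apply (rotGen i j).continuous).add
      (hd.continuous.clm_apply ((rotGen i j).continuous.comp (rotGen i j).continuous))
  have hS : ∀ i j, i ≠ j → ∫ w : Sphere2, S i j w ∂sphereMeasure = 0 := by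
    intro i j hij
    have hk : ContDiff ℝ ∞ fun y => fderiv ℝ h y (rotGen i j y) :=
      hd.clm_apply (rotGen i j).contDiff
    have h1 := integral_rotation_deriv (rotGen_skew i j) (rotGen_cube hij)
      (hk.of_le (by exact_mod_cast le_top))
    rw [← h1]
    refine integral_congr_ae (Eventually.of_forall fun w => ?_)
    have h2 := ((hd.differentiable (by simp)) (w : Space3)).hasFDerivAt.clm_apply
      ((rotGen i j).hasFDerivAt (x := (w : Space3)))
    simp only [h2.fderiv, S]
    simp [add_comm]
  have hsum : ∀ w : Sphere2, ∑ i, fderiv ℝ (fderiv ℝ h) w (spaceBasis i) (spaceBasis i)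
      - fderiv ℝ (fderiv ℝ h) w w w - 2 * fderiv ℝ h w w = S 0 1 w + S 0 2 w + S 1 2 w := by
    intro w
    have hw : (w : Space3) = (w : Space3) 0 • spaceBasis 0 + (w : Space3) 1 • spaceBasis 1
        + (w : Space3) 2 • spaceBasis 2 := by
      ext i
      fin_cases i <;> simp [spaceBasis_apply]
    have hone := sum_sq_sphere w
    simp only [S]
    rw [rotGen_sq (by decide), rotGen_sq (by decide), rotGen_sq (by decide)]
    simp only [rotGen_apply]
    generalize fderiv ℝ (fderiv ℝ h) (w : Space3) = H
    generalize fderiv ℝ h (w : Space3) = l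
    have e1 : H w w = H ((w : Space3) 0 • spaceBasis 0 + (w : Space3) 1 • spaceBasis 1
        + (w : Space3) 2 • spaceBasis 2) ((w : Space3) 0 • spaceBasis 0
        + (w : Space3) 1 • spaceBasis 1 + (w : Space3) 2 • spaceBasis 2) := by rw [← hw]
    have e2 : l w = l ((w : Space3) 0 • spaceBasis 0 + (w : Space3) 1 • spaceBasis 1
        + (w : Space3) 2 • spaceBasis 2) := by rw [← hw]
    rw [e1, e2]
    simp only [map_add, map_sub, map_neg, map_smul, add_apply, sub_apply, smul_apply,
      smul_eq_mul, Fin.sum_univ_three]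
    linear_combination (-(H (spaceBasis 0) (spaceBasis 0)) - H (spaceBasis 1) (spaceBasis 1)
      - H (spaceBasis 2) (spaceBasis 2)) * hone
  simp only [hsum]
  rw [integral_add (f := fun w : Sphere2 => S 0 1 w + S 0 2 w)
      (integrable_sphere ((hScont 0 1).add (hScont 0 2))) (integrable_sphere (hScont 1 2)),
    integral_add (integrable_sphere (hScont 0 1)) (integrable_sphere (hScont 0 2)),
    hS 0 1 (by decide), hS 0 2 (by decide), hS 1 2 (by decide)]
  simp

/-! ### Kirchhoff's formula -/

section Kirchhoff

variable {f : Spacetime → ℝ}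

lemma hasFDerivAt_slice_affine (hf : ContDiffOn ℝ ∞ f (futureRegion ∩ Set.univ)) {τ : ℝ}
    (hτ : 0 ≤ τ) (x : Space3) (s : ℝ) (y : Space3) :
    HasFDerivAt (fun y : Space3 => f (τ, x + s • y))
      (s • (fderivWithin ℝ f futureRegion (τ, x + s • y)).comp
        (ContinuousLinearMap.inr ℝ ℝ Space3)) y := by
  have h1 : HasFDerivAt (fun y : Space3 => x + s • y) (s • ContinuousLinearMap.id ℝ Space3) y :=
    ((hasFDerivAt_id y).const_smul s).const_add x
  refine ((hasFDerivAt_slice (f := f) isOpen_univ hf (T := τ) (X := x + s • y)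
    ⟨hτ, trivial⟩).comp y h1).congr_fderiv ?_
  ext v
  simp

lemma contDiff_slice_affine (hf : ContDiffOn ℝ ∞ f futureRegion) {τ : ℝ}
    (hτ : 0 ≤ τ) (x : Space3) (s : ℝ) : ContDiff ℝ ∞ fun y : Space3 => f (τ, x + s • y) := by
  have h : ContDiff ℝ ∞ fun y : Space3 => ((τ, x + s • y) : Spacetime) := by fun_prop
  exact contDiffOn_univ.1 (hf.comp h.contDiffOn fun y _ => hτ)

lemma fderiv_slice_affine (hf : ContDiffOn ℝ ∞ f (futureRegion ∩ Set.univ)) {τ : ℝ}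
    (hτ : 0 ≤ τ) (x : Space3) (s : ℝ) (y v : Space3) :
    fderiv ℝ (fun y : Space3 => f (τ, x + s • y)) y v
      = s * cDeriv (0, v) f (τ, x + s • y) := by
  rw [(hasFDerivAt_slice_affine hf hτ x s y).fderiv]
  rfl

lemma fderiv_fderiv_slice_affine (hf : ContDiffOn ℝ ∞ f (futureRegion ∩ Set.univ)) {τ : ℝ}
    (hτ : 0 ≤ τ) (x : Space3) (s : ℝ) (y v u : Space3) :
    fderiv ℝ (fderiv ℝ fun y : Space3 => f (τ, x + s • y)) y v u
      = s * (s * cDeriv (0, v) (cDeriv (0, u) f) (τ, x + s • y)) := by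
  have hd : DifferentiableAt ℝ (fderiv ℝ fun y : Space3 => f (τ, x + s • y)) y :=
    (((contDiff_slice_affine (by simpa using hf) hτ x s).fderiv_right (m := ∞)
      (by simp)).differentiable (by simp)) y
  have h1 := hd.hasFDerivAt.clm_apply (hasFDerivAt_const u y)
  have h2 : (fun y => fderiv ℝ (fun y : Space3 => f (τ, x + s • y)) y u)
      = fun y => s * cDeriv (0, u) f (τ, x + s • y) := by
    funext z
    exact fderiv_slice_affine hf hτ x s z u
  have h3 := (hasFDerivAt_slice_affine (contDiffOn_cDeriv (0, u) isOpen_univ hf) hτ x s y).const_mul s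
  rw [← h2] at h3
  have h4 := congrArg (fun L : Space3 →L[ℝ] ℝ => L v) (h1.unique h3)
  simpa [cDeriv, dirDeriv] using h4

lemma cDeriv_space (w : Space3) (f : Spacetime → ℝ) (p : Spacetime) :
    cDeriv (0, w) f p = ∑ i, w i * cDeriv (eX i) f p := by
  have hw : ((0, w) : Spacetime) = ∑ i, w i • eX i := spaceScaling_eq_sum (p.1, w)
  rw [hw, Fin.sum_univ_three, Fin.sum_univ_three, cDeriv_vec_add, cDeriv_vec_add]
  simp only [cDeriv_vec_smul]

/-- Kirchhoff's formula. Along the backward light cone of `(T, x)` the spherical means of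
`f + s (∂_T + ∂_s) f` do not depend on `s`: by the wave equation their derivative is the
integral of a spherical Laplacian. -/
theorem IsGoodSolution.kirchhoff (hf : IsGoodSolution f) {T : ℝ} (hT : 0 ≤ T) (x : Space3) :
    sphereMeasure.real Set.univ * f (T, x) = ∫ w : Sphere2, (f (0, x + T • (w : Space3))
      + T * cDeriv (1, (w : Space3)) f (0, x + T • (w : Space3))) ∂sphereMeasure := by
  have hU := isOpen_univ (X := Spacetime)
  have hfU := hf.contDiffOn_univ
  let P : ℝ → Sphere2 → Spacetime := fun s w => (T - s, x + s • (w : Space3))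
  let f' := fderivWithin ℝ f futureRegion
  let f'' := fderivWithin ℝ f' futureRegion
  have hf's : ContDiffOn ℝ ∞ f' futureRegion := by
    simpa using contDiffOn_fderivWithin_future hU hfU
  have hf''c : ContinuousOn f'' futureRegion :=
    hf's.continuousOn_fderivWithin uniqueDiffOn_futureRegion (by simp)
  have hPc : Continuous fun z : ℝ × Sphere2 => P z.1 z.2 := by fun_prop
  have hPmem : ∀ s ∈ Set.Icc 0 T, ∀ w, P s w ∈ futureRegion := fun s hs w => sub_nonneg.2 hs.2
  let G : ℝ → Sphere2 → ℝ := fun s w => f (P s w) + s * f' (P s w) (1, (w : Space3))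
  let G' : ℝ → Sphere2 → ℝ := fun s w => 2 * f' (P s w) (0, (w : Space3))
    + s * (-f'' (P s w) eT eT + f'' (P s w) (0, (w : Space3)) (0, (w : Space3)))
  have hmaps : Set.MapsTo (fun z : ℝ × Sphere2 => P z.1 z.2) (Set.Icc 0 T ×ˢ Set.univ)
      futureRegion := fun z hz => hPmem z.1 hz.1 z.2
  have hfP : ContinuousOn (fun z : ℝ × Sphere2 => f (P z.1 z.2)) (Set.Icc 0 T ×ˢ Set.univ) :=
    hf.smooth.continuousOn.comp hPc.continuousOn hmaps
  have hf'P : ContinuousOn (fun z : ℝ × Sphere2 => f' (P z.1 z.2)) (Set.Icc 0 T ×ˢ Set.univ) :=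
    hf's.continuousOn.comp hPc.continuousOn hmaps
  have hf''P : ContinuousOn (fun z : ℝ × Sphere2 => f'' (P z.1 z.2)) (Set.Icc 0 T ×ˢ Set.univ) :=
    hf''c.comp hPc.continuousOn hmaps
  have hG'c : ContinuousOn (Function.uncurry G') (Set.Icc 0 T ×ˢ Set.univ) := by
    have hw : ContinuousOn (fun z : ℝ × Sphere2 => ((0, (z.2 : Space3)) : Spacetime))
        (Set.Icc 0 T ×ˢ Set.univ) := by fun_prop
    exact (continuousOn_const.mul (hf'P.clm_apply hw)).add (continuousOn_fst.mul
      (((hf''P.clm_apply continuousOn_const).clm_apply continuousOn_const).neg.add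
        ((hf''P.clm_apply hw).clm_apply hw)))
  have hGc : ContinuousOn (Function.uncurry G) (Set.Icc 0 T ×ˢ Set.univ) := by
    have hw : ContinuousOn (fun z : ℝ × Sphere2 => ((1, (z.2 : Space3)) : Spacetime))
        (Set.Icc 0 T ×ˢ Set.univ) := by fun_prop
    exact hfP.add (continuousOn_fst.mul (hf'P.clm_apply hw))
  have hGw : ∀ s ∈ Set.Icc 0 T, Continuous (G s) := fun s hs =>
    continuousOn_univ.1 (hGc.comp (f := fun w : Sphere2 => (s, w)) (by fun_prop)
      fun w _ => ⟨hs, trivial⟩)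
  have key := integral_eq_of_integral_deriv_eq_zero sphereMeasure hT (G := G) (G' := G')
    isCompact_univ hG'c (fun _ _ w hw => absurd (Set.mem_univ w) hw)
    (fun w => hGc.comp (f := fun s => (s, w)) (by fun_prop) fun s hs => ⟨hs, trivial⟩)
    (fun w s hs => ?_) (fun s hs => ?_)
    (integrable_sphere (hGw 0 ⟨le_rfl, hT⟩)) (integrable_sphere (hGw T ⟨hT, le_rfl⟩))
  · have e0 : ∀ w : Sphere2, G 0 w = f (T, x) := fun w => by simp [G, P]
    have eT' : ∀ w : Sphere2, G T w = f (0, x + T • (w : Space3))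
        + T * cDeriv (1, (w : Space3)) f (0, x + T • (w : Space3)) := fun w => by
      simp only [G, P, sub_self]
      rfl
    simp only [e0, eT'] at key
    rw [key]
    simp
  · -- the derivative along the generators of the cone
    have hsI : s ∈ Set.Icc 0 T := Set.Ioo_subset_Icc_self hs
    have hp : P s w ∈ futureRegion ∩ Set.univ := ⟨hPmem s hsI w, trivial⟩
    have hPd : HasDerivAt (fun s => P s w) (-1, (w : Space3)) s := by
      have h1 : HasDerivAt (fun s : ℝ => T - s) (-1) s := by
        simpa using (hasDerivAt_id s).const_sub T
      have h2 : HasDerivAt (fun s : ℝ => x + s • (w : Space3)) (w : Space3) s := by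
        simpa using ((hasDerivAt_id s).smul_const (w : Space3)).const_add x
      exact h1.prodMk h2
    have hev : ∀ᶠ t in 𝓝 s, P t w ∈ futureRegion := by
      filter_upwards [Iio_mem_nhds hs.2] with t ht
      exact (sub_pos.2 (Set.mem_Iio.1 ht)).le
    have d1 : HasDerivAt (fun s => f (P s w)) (f' (P s w) (-1, (w : Space3))) s :=
      (hasFDerivWithinAt_future hU hfU hp).comp_hasDerivAt s hPd hev
    have d2 : HasDerivAt (fun s => f' (P s w)) (f'' (P s w) (-1, (w : Space3))) s :=
      ((hf's (P s w) hp.1).differentiableWithinAt (by simp)).hasFDerivWithinAt.comp_hasDerivAt s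
        hPd hev
    have d3 : HasDerivAt (fun s => f' (P s w) (1, (w : Space3)))
        (f'' (P s w) (-1, (w : Space3)) (1, (w : Space3))) s := by
      simpa using d2.clm_apply (hasDerivAt_const s ((1, (w : Space3)) : Spacetime))
    refine (d1.fun_add ((hasDerivAt_id s).fun_mul d3)).congr_deriv ?_
    have hsymm : f'' (P s w) eT (0, (w : Space3)) = f'' (P s w) (0, (w : Space3)) eT := by
      have := cDeriv_comm eT (0, (w : Space3)) hU hfU hp
      rwa [cDeriv_cDeriv_apply _ _ hU hfU hp, cDeriv_cDeriv_apply _ _ hU hfU hp] at this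
    have v1 : ((-1, (w : Space3)) : Spacetime) = -eT + (0, (w : Space3)) := by simp [eT]
    have v2 : ((1, (w : Space3)) : Spacetime) = eT + (0, (w : Space3)) := by simp [eT]
    simp only [G', v1, v2, map_add, map_neg, add_apply, neg_apply, hsymm, id]
    ring
  · -- `s G'` is minus the spherical Laplacian of `y ↦ f (T - s, x + s y)`
    have hsI : s ∈ Set.Icc 0 T := Set.Ioo_subset_Icc_self hs
    have hτ : 0 ≤ T - s := sub_nonneg.2 hsI.2
    have hlap := integral_sphere_laplacian (contDiff_slice_affine hf.smooth hτ x s)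
    have hpt : ∀ w : Sphere2,
        ∑ i, fderiv ℝ (fderiv ℝ fun y : Space3 => f (T - s, x + s • y)) w (spaceBasis i)
          (spaceBasis i) - fderiv ℝ (fderiv ℝ fun y : Space3 => f (T - s, x + s • y)) w w w
          - 2 * fderiv ℝ (fun y : Space3 => f (T - s, x + s • y)) w w = -s * G' s w := by
      intro w
      have hp : P s w ∈ futureRegion ∩ Set.univ := ⟨hPmem s hsI w, trivial⟩
      have hw := hf.eqn _ hp.1
      rw [waveOp_eq] at hw
      simp only [fderiv_fderiv_slice_affine hfU hτ, fderiv_slice_affine hfU hτ]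
      have g1 : f'' (P s w) eT eT = cDeriv eT (cDeriv eT f) (P s w) :=
        (cDeriv_cDeriv_apply _ _ hU hfU hp).symm
      have g2 : f'' (P s w) (0, (w : Space3)) (0, (w : Space3))
          = cDeriv (0, (w : Space3)) (cDeriv (0, (w : Space3)) f) (P s w) :=
        (cDeriv_cDeriv_apply _ _ hU hfU hp).symm
      have g3 : f' (P s w) (0, (w : Space3)) = cDeriv (0, (w : Space3)) f (P s w) := rfl
      simp only [G']
      rw [g1, g2, g3]
      change ∑ i, s * (s * cDeriv (eX i) (cDeriv (eX i) f) (P s w)) - s * (s * cDeriv (0, (w : Space3))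
        (cDeriv (0, (w : Space3)) f) (P s w)) - 2 * (s * cDeriv (0, (w : Space3)) f (P s w)) = _
      rw [← Finset.mul_sum, ← Finset.mul_sum]
      linear_combination s * s * hw
    simp only [hpt] at hlap
    rw [integral_const_mul] at hlap
    exact (mul_eq_zero.1 hlap).resolve_left (neg_ne_zero.2 hs.1.ne')

end Kirchhoff

lemma sphereMeasure_real_univ_pos : 0 < sphereMeasure.real Set.univ := by
  rw [sphereMeasure, Measure.toSphere_real_apply_univ]
  have : 0 < (volume : Measure Space3).real (Metric.ball 0 1) :=
    ENNReal.toReal_pos (Metric.measure_ball_pos _ _ one_pos).ne' measure_ball_lt_top.ne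
  simp only [finrank_euclideanSpace, Fintype.card_fin]
  positivity

/-- The Kirchhoff integrand vanishes outside the support of the data. -/
lemma IsGoodSolution.kirchhoff_integrand_eq_zero {f : Spacetime → ℝ} {ρ : ℝ}
    (hf : IsGoodSolution f) (hd : DataSupportedIn ρ f) {y : Space3} (hy : ρ < ‖y‖) (v : Space3) :
    f (0, y) = 0 ∧ cDeriv (1, v) f (0, y) = 0 := by
  refine ⟨(hd y hy).1, ?_⟩
  have hv : ((1, v) : Spacetime) = eT + (0, v) := by simp [eT]
  have hT : cDeriv eT f (0, y) = 0 := (hd y hy).2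
  rw [hv, cDeriv_vec_add, cDeriv_space, hT]
  simp [fun i => cDeriv_eX_eq_zero_of_slice isOpen_univ hf.contDiffOn_univ
    (mem_future_univ (p := ((0, y) : Spacetime)) (le_refl (0 : ℝ))) (fun Z hZ => (hd Z hZ).1) hy i]

/-- Strong Huygens principle. -/
lemma IsGoodSolution.huygens {f : Spacetime → ℝ} {ρ : ℝ}
    (hf : IsGoodSolution f) (hd : DataSupportedIn ρ f) {T : ℝ} (hT : 0 ≤ T) {x : Space3}
    (h : ρ < |T - ‖x‖|) : f (T, x) = 0 := by
  have hk := hf.kirchhoff hT x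
  have h0 : ∀ w : Sphere2, f (0, x + T • (w : Space3))
      + T * cDeriv (1, (w : Space3)) f (0, x + T • (w : Space3)) = 0 := by
    intro w
    have hn : |T - ‖x‖| ≤ ‖x + T • (w : Space3)‖ := by
      have h1 := abs_norm_sub_norm_le (T • (w : Space3)) (-x)
      rw [norm_smul, norm_sphere, norm_neg, sub_neg_eq_add, Real.norm_of_nonneg hT, mul_one,
        add_comm (T • (w : Space3))] at h1
      exact h1
    obtain ⟨h1, h2⟩ := hf.kirchhoff_integrand_eq_zero hd (h.trans_le hn) w
    rw [h1, h2]; simp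
  simp only [h0, integral_zero] at hk
  exact (mul_eq_zero.1 hk).resolve_left sphereMeasure_real_univ_pos.ne'

/-- Finite speed of propagation for all the functions `Γ^I f`. -/
lemma IsGoodSolution.gammaPow_eq_zero {f : Spacetime → ℝ} {ρ : ℝ}
    (hf : IsGoodSolution f) (hd : DataSupportedIn ρ f) (I : List GammaIdx) {T : ℝ} (hT : 0 ≤ T)
    {x : Space3} (h : ρ + T < ‖x‖) : _root_.gammaPow I f (T, x) = 0 := by
  have hV : IsOpen {p : Spacetime | ρ + p.1 < ‖p.2‖} :=
    isOpen_lt (by fun_prop) (by fun_prop)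
  refine gammaPow_eqOn_zero hV (fun p hp => ?_) I _
    ⟨hT, show ρ + T < ‖x‖ from h⟩
  refine hf.huygens hd hp.1 ?_
  have : ρ + p.1 < ‖p.2‖ := hp.2
  rw [abs_sub_comm]
  exact lt_of_lt_of_le (by linarith) (le_abs_self _)

/-! ### Conservation of energy -/

section Energy

variable {f : Spacetime → ℝ}

lemma hasDerivAt_time (hf : ContDiffOn ℝ ∞ f (futureRegion ∩ Set.univ)) {s : ℝ} (hs : 0 < s)
    (x : Space3) : HasDerivAt (fun t => f (t, x)) (cDeriv eT f (s, x)) s := by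
  have h1 : HasDerivAt (fun t : ℝ => ((t, x) : Spacetime)) (1, 0) s :=
    (hasDerivAt_id s).prodMk (hasDerivAt_const s x)
  have hev : ∀ᶠ t in 𝓝 s, ((t, x) : Spacetime) ∈ futureRegion := by
    filter_upwards [Ioi_mem_nhds hs] with t ht
    exact le_of_lt (Set.mem_Ioi.1 ht)
  exact (hasFDerivWithinAt_future isOpen_univ hf
    (mem_future_univ (p := (s, x)) hs.le)).comp_hasDerivAt s h1 hev

lemma continuous_slice (hf : ContinuousOn f futureRegion) {T : ℝ} (hT : 0 ≤ T) :
    Continuous fun x : Space3 => f (T, x) :=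
  continuousOn_univ.1 (hf.comp (f := fun x : Space3 => ((T, x) : Spacetime)) (by fun_prop)
    fun _ _ => hT)

lemma hasCompactSupport_of_eq_zero {k : Space3 → ℝ} {r : ℝ} (h : ∀ x, r < ‖x‖ → k x = 0) :
    HasCompactSupport k :=
  HasCompactSupport.intro (isCompact_closedBall (0 : Space3) r) fun x hx =>
    h x (by simpa using hx)

/-- The integral of a spatial derivative of a compactly supported function vanishes. -/
lemma integral_cDeriv_eX_eq_zero (hf : ContDiffOn ℝ ∞ f (futureRegion ∩ Set.univ)) {s r : ℝ}
    (hs : 0 ≤ s) (h0 : ∀ x : Space3, r < ‖x‖ → f (s, x) = 0) (i : Fin 3) :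
    ∫ x : Space3, cDeriv (eX i) f (s, x) = 0 := by
  have hd : ∀ x, HasFDerivAt (fun x : Space3 => f (s, x)) _ x := fun x =>
    hasFDerivAt_slice isOpen_univ hf (mem_future_univ (p := (s, x)) hs)
  have he : ∀ x : Space3, fderiv ℝ (fun x : Space3 => f (s, x)) x (spaceBasis i)
      = cDeriv (eX i) f (s, x) := fun x => by rw [(hd x).fderiv]; rfl
  have hfc : ContinuousOn f futureRegion := by simpa using hf.continuousOn
  have hec : ContinuousOn (cDeriv (eX i) f) futureRegion := by
    simpa using (contDiffOn_cDeriv (eX i) isOpen_univ hf).continuousOn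
  have hint : Integrable fun x : Space3 => f (s, x) :=
    (continuous_slice hfc hs).integrable_of_hasCompactSupport (hasCompactSupport_of_eq_zero h0)
  have hint' : Integrable fun x : Space3 => cDeriv (eX i) f (s, x) :=
    (continuous_slice hec hs).integrable_of_hasCompactSupport (hasCompactSupport_of_eq_zero
      fun x hx => cDeriv_eX_eq_zero_of_slice isOpen_univ hf (mem_future_univ (p := (s, x)) hs)
        h0 hx i)
  have h := integral_mul_fderiv_eq_neg_fderiv_mul_of_integrable (μ := (volume : Measure Space3))
    (f := fun _ => (1 : ℝ)) (g := fun x => f (s, x)) (v := spaceBasis i) (by simp)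
    (by simpa [he] using hint') (by simpa using hint) (fun x _ => by fun_prop)
    (fun x _ => (hd x).differentiableAt)
  simpa [he] using h

lemma energyDensity_eq (f : Spacetime → ℝ) (T : ℝ) (x : Space3) :
    energyDensity f T x = cDeriv eT f (T, x) ^ 2 + ∑ i, cDeriv (eX i) f (T, x) ^ 2 := rfl

lemma energyDensity_nonneg (f : Spacetime → ℝ) (T : ℝ) (x : Space3) : 0 ≤ energyDensity f T x := by
  rw [energyDensity_eq]; positivity

lemma energy_nonneg (f : Spacetime → ℝ) (T : ℝ) : 0 ≤ energy f T := Real.sqrt_nonneg _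

variable {ρ : ℝ}

lemma cDeriv_eq_zero_of_finite_speed
    (h0 : ∀ T : ℝ, 0 ≤ T → ∀ x : Space3, ρ + T < ‖x‖ → f (T, x) = 0) (e : Spacetime)
    {T : ℝ} (hT : 0 ≤ T) {x : Space3} (hx : ρ + T < ‖x‖) : cDeriv e f (T, x) = 0 := by
  have hV : IsOpen {p : Spacetime | ρ + p.1 < ‖p.2‖} := isOpen_lt (by fun_prop) (by fun_prop)
  have hp : ((T, x) : Spacetime) ∈ futureRegion ∩ {p : Spacetime | ρ + p.1 < ‖p.2‖} :=
    ⟨hT, show ρ + T < ‖x‖ from hx⟩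
  rw [cDeriv_congr (g := fun _ => 0) e hV (fun p hp => h0 p.1 hp.1 p.2 hp.2) hp, cDeriv_const]

lemma IsGoodSolution.integrable_energyDensity (hf : IsGoodSolution f)
    (h0 : ∀ T : ℝ, 0 ≤ T → ∀ x : Space3, ρ + T < ‖x‖ → f (T, x) = 0) {T : ℝ} (hT : 0 ≤ T) :
    Integrable (energyDensity f T) := by
  have hc : ∀ e, Continuous fun x : Space3 => cDeriv e f (T, x) := fun e =>
    continuous_slice (by simpa using
      (contDiffOn_cDeriv e isOpen_univ hf.contDiffOn_univ).continuousOn) hT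
  have hcont : Continuous (energyDensity f T) := by
    simp only [funext (energyDensity_eq f T)]
    exact ((hc eT).pow 2).add (continuous_finsetSum _ fun i _ => (hc (eX i)).pow 2)
  refine hcont.integrable_of_hasCompactSupport
    (hasCompactSupport_of_eq_zero (r := ρ + T) fun x hx => ?_)
  rw [energyDensity_eq]
  simp [fun e => cDeriv_eq_zero_of_finite_speed h0 e hT hx]

/-- Energy conservation: `∂_T` of the energy density is the divergence `2 ∂_i (∂_T f ∂_i f)`. -/
theorem IsGoodSolution.energy_eq (hf : IsGoodSolution f)
    (h0 : ∀ T : ℝ, 0 ≤ T → ∀ x : Space3, ρ + T < ‖x‖ → f (T, x) = 0) {T : ℝ} (hT : 0 ≤ T) :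
    energy f T = energy f 0 := by
  have hU := isOpen_univ (X := Spacetime)
  have hfU := hf.contDiffOn_univ
  have hs1 := fun e => contDiffOn_cDeriv e hU hfU
  have hs2 := fun e e' => contDiffOn_cDeriv e' hU (hs1 e)
  have hz := fun (e : Spacetime) (s : ℝ) (hs : 0 ≤ s) (x : Space3) (hx : ρ + s < ‖x‖) =>
    cDeriv_eq_zero_of_finite_speed h0 e hs hx
  let G' : ℝ → Space3 → ℝ := fun s x =>
    2 * (cDeriv eT f (s, x) * cDeriv eT (cDeriv eT f) (s, x)
      + ∑ i, cDeriv (eX i) f (s, x) * cDeriv eT (cDeriv (eX i) f) (s, x))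
  have hsub : Set.Icc 0 T ×ˢ Set.univ ⊆ (futureRegion ∩ Set.univ : Set Spacetime) :=
    fun p hp => ⟨hp.1.1, trivial⟩
  have hG'c : ContinuousOn (Function.uncurry G') (Set.Icc 0 T ×ˢ Set.univ) := by
    refine ContinuousOn.mono (s := futureRegion ∩ Set.univ) ?_ hsub
    exact continuousOn_const.mul (((hs1 eT).continuousOn.mul (hs2 eT eT).continuousOn).add
      (continuousOn_finsetSum _ fun i _ =>
        (hs1 (eX i)).continuousOn.mul (hs2 (eX i) eT).continuousOn))
  have hG : ContinuousOn (fun p : Spacetime => energyDensity f p.1 p.2)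
      (futureRegion ∩ Set.univ) :=
    ((hs1 eT).continuousOn.pow 2).add
      (continuousOn_finsetSum _ fun i _ => (hs1 (eX i)).continuousOn.pow 2)
  have key := integral_eq_of_integral_deriv_eq_zero (volume : Measure Space3) hT
    (G := energyDensity f) (G' := G') (isCompact_closedBall (0 : Space3) (ρ + T)) hG'c
    (fun s hs x hx => ?_) (fun x => ?_) (fun x s hs => ?_) (fun s hs => ?_)
    (hf.integrable_energyDensity h0 le_rfl) (hf.integrable_energyDensity h0 hT)
  · rw [energy, energy, key]
  · have hx' : ρ + s < ‖x‖ := by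
      have : ρ + T < ‖x‖ := by simpa using hx
      linarith [hs.2]
    simp only [G', fun e => hz e s hs.1 x hx']
    simp
  · exact hG.comp (f := fun s => ((s, x) : Spacetime)) (by fun_prop) fun s hs => ⟨hs.1, trivial⟩
  · have h1 := fun e => (hasDerivAt_time (hs1 e) hs.1 x).fun_pow 2
    refine ((h1 eT).fun_add (HasDerivAt.fun_sum (u := Finset.univ)
      fun i _ => h1 (eX i))).congr_deriv ?_
    simp only [G', Fin.sum_univ_three]
    push_cast
    ring
  · have hs0 : 0 ≤ s := hs.1.le
    have hdiv : ∀ x, G' s x = ∑ i, 2 * cDeriv (eX i) (fun p => cDeriv eT f p * cDeriv (eX i) f p)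
        (s, x) := by
      intro x
      have hp := mem_future_univ (p := ((s, x) : Spacetime)) hs0
      have hw := hf.eqn _ hp.1
      rw [waveOp_eq, Fin.sum_univ_three] at hw
      simp only [fun i => cDeriv_mul (eX i) hU (hs1 eT) (hs1 (eX i)) hp, G', Fin.sum_univ_three,
        fun i => cDeriv_comm eT (eX i) hU hfU hp]
      linear_combination (-2 * cDeriv eT f (s, x)) * hw
    have hint : ∀ i, Integrable fun x : Space3 =>
        2 * cDeriv (eX i) (fun p => cDeriv eT f p * cDeriv (eX i) f p) (s, x) := fun i => by
      refine Integrable.const_mul ?_ 2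
      refine (continuous_slice (by simpa using (contDiffOn_cDeriv (eX i) hU
        ((hs1 eT).mul (hs1 (eX i)))).continuousOn) hs0).integrable_of_hasCompactSupport
        (hasCompactSupport_of_eq_zero (r := ρ + s) fun x hx => ?_)
      exact cDeriv_eq_zero_of_finite_speed (ρ := ρ)
        (fun t ht y hy => by simp [hz eT t ht y hy]) (eX i) hs0 hx
    simp only [hdiv]
    rw [integral_finsetSum _ fun i _ => hint i]
    refine Finset.sum_eq_zero fun i _ => ?_
    rw [integral_const_mul, integral_cDeriv_eX_eq_zero ((hs1 eT).mul (hs1 (eX i))) hs0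
      (r := ρ + s) (fun x hx => by simp [hz eT s hs0 x hx]), mul_zero]

end Energy

/-! ### Weighted bounds along a ray -/

section Ray

lemma mul_abs_le_integral_of_hasDerivAt {H H' B : ℝ → ℝ} {t M k : ℝ} (htM : t ≤ M) (hk : 0 ≤ k)
    (hH : ∀ s, HasDerivAt H (H' s) s) (hH' : Continuous H') (hB : Continuous B) (hM : H M = 0)
    (hle : ∀ s ∈ Set.Icc t M, k * |H' s| ≤ B s) : k * |H t| ≤ ∫ s in t..M, B s := by
  have h1 : ∫ s in t..M, H' s = -H t := by
    rw [intervalIntegral.integral_eq_sub_of_hasDerivAt (fun s _ => hH s)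
      (hH'.intervalIntegrable _ _), hM, zero_sub]
  calc k * |H t| = k * |∫ s in t..M, H' s| := by rw [h1, abs_neg]
    _ ≤ k * ∫ s in t..M, |H' s| :=
        mul_le_mul_of_nonneg_left (intervalIntegral.abs_integral_le_integral_abs htM) hk
    _ = ∫ s in t..M, k * |H' s| := (intervalIntegral.integral_const_mul _ _).symm
    _ ≤ ∫ s in t..M, B s := intervalIntegral.integral_mono_on htM
        ((continuous_const.mul hH'.abs).intervalIntegrable _ _) (hB.intervalIntegrable _ _) hle

variable {η η₁ η₂ η₃ : ℝ → ℝ} {t M : ℝ}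

lemma sq_mul_abs_le_integral (ht : 0 ≤ t) (htM : t ≤ M) (h1 : ∀ s, HasDerivAt η (η₁ s) s)
    (hc : Continuous η₁) (h0 : η M = 0) : t ^ 2 * |η t| ≤ ∫ s in t..M, s ^ 2 * |η₁ s| :=
  mul_abs_le_integral_of_hasDerivAt htM (sq_nonneg t) h1 hc ((continuous_id.pow 2).mul hc.abs) h0
    fun _ hs => mul_le_mul_of_nonneg_right (pow_le_pow_left₀ ht hs.1 2) (abs_nonneg _)

/-- Taylor's formula at infinity, `η(t) = ∫ (s - t) η''(s) ds`, and `t (s - t) ≤ s²`. -/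
lemma mul_abs_le_integral (ht : 0 ≤ t) (htM : t ≤ M) (h1 : ∀ s, HasDerivAt η (η₁ s) s)
    (h2 : ∀ s, HasDerivAt η₁ (η₂ s) s) (hc : Continuous η₂) (h0 : η M = 0) (h10 : η₁ M = 0) :
    t * |η t| ≤ ∫ s in t..M, s ^ 2 * |η₂ s| := by
  have hH : ∀ s, HasDerivAt (fun s => (s - t) * η₁ s - η s) ((s - t) * η₂ s) s := fun s => by
    refine ((((hasDerivAt_id s).sub_const t).fun_mul (h2 s)).fun_sub (h1 s)).congr_deriv ?_
    simp
  have := mul_abs_le_integral_of_hasDerivAt htM ht hH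
    ((continuous_id.sub continuous_const).mul hc) ((continuous_id.pow 2).mul hc.abs)
    (by simp [h0, h10]) fun s hs => ?_
  · simpa using this
  · have hst : 0 ≤ s - t := sub_nonneg.2 hs.1
    rw [abs_mul, abs_of_nonneg hst, ← mul_assoc]
    refine mul_le_mul_of_nonneg_right ?_ (abs_nonneg _)
    change t * (s - t) ≤ s ^ 2
    nlinarith [hs.1]

/-- Taylor's formula at infinity, `η(t) = -½ ∫ (s - t)² η'''(s) ds`. -/
lemma abs_le_integral (ht : 0 ≤ t) (htM : t ≤ M) (h1 : ∀ s, HasDerivAt η (η₁ s) s)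
    (h2 : ∀ s, HasDerivAt η₁ (η₂ s) s) (h3 : ∀ s, HasDerivAt η₂ (η₃ s) s) (hc : Continuous η₃)
    (h0 : η M = 0) (h10 : η₁ M = 0) (h20 : η₂ M = 0) :
    |η t| ≤ ∫ s in t..M, s ^ 2 * |η₃ s| := by
  have hH : ∀ s, HasDerivAt (fun s => (s - t) * η₁ s - η s - 1 / 2 * ((s - t) ^ 2 * η₂ s))
      (-(1 / 2 * ((s - t) ^ 2 * η₃ s))) s := fun s => by
    have hl := (hasDerivAt_id s).sub_const t
    refine (((hl.fun_mul (h2 s)).fun_sub (h1 s)).fun_sub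
      (((hl.fun_pow 2).fun_mul (h3 s)).const_mul (1 / 2))).congr_deriv ?_
    simp
    ring
  have := mul_abs_le_integral_of_hasDerivAt htM zero_le_one hH (by fun_prop)
    ((continuous_id.pow 2).mul hc.abs) (by simp [h0, h10, h20]) fun s hs => ?_
  · simpa using this
  · have hst : 0 ≤ s - t := sub_nonneg.2 hs.1
    rw [one_mul, abs_neg, abs_mul, abs_mul, ← mul_assoc]
    refine mul_le_mul_of_nonneg_right ?_ (abs_nonneg _)
    rw [abs_of_nonneg (by norm_num : (0 : ℝ) ≤ 1 / 2), abs_of_nonneg (sq_nonneg (s - t))]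
    change 1 / 2 * (s - t) ^ 2 ≤ s ^ 2
    nlinarith [hs.1]

end Ray

/-! ### Bounds for the initial data -/

section Data

variable {f : Spacetime → ℝ} {ρ : ℝ}

lemma abs_sphere_apply_le (w : Sphere2) (i : Fin 3) : |(w : Space3) i| ≤ 1 := by
  have := PiLp.norm_apply_le (w : Space3) i
  rwa [norm_sphere, Real.norm_eq_abs] at this

lemma abs_cDeriv_space_le (w : Sphere2) (f : Spacetime → ℝ) (p : Spacetime) :
    |cDeriv (0, (w : Space3)) f p| ≤ ∑ i, |cDeriv (eX i) f p| := by
  rw [cDeriv_space]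
  refine (Finset.abs_sum_le_sum_abs _ _).trans (Finset.sum_le_sum fun i _ => ?_)
  rw [abs_mul]
  exact mul_le_of_le_one_left (abs_nonneg _) (abs_sphere_apply_le w i)

lemma abs_cDeriv_space_two_le (w : Sphere2) (hf : ContDiffOn ℝ ∞ f (futureRegion ∩ Set.univ))
    {p : Spacetime} (hp : p ∈ futureRegion ∩ Set.univ) :
    |cDeriv (0, (w : Space3)) (cDeriv (0, (w : Space3)) f) p|
      ≤ ∑ i, ∑ j, |cDeriv (eX j) (cDeriv (eX i) f) p| := by
  refine (abs_cDeriv_space_le w _ p).trans (Finset.sum_le_sum fun i _ => ?_)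
  rw [cDeriv_comm _ _ isOpen_univ hf hp]
  exact abs_cDeriv_space_le w _ p

lemma abs_cDeriv_space_three_le (w : Sphere2) (hf : ContDiffOn ℝ ∞ f (futureRegion ∩ Set.univ))
    {p : Spacetime} (hp : p ∈ futureRegion ∩ Set.univ) :
    |cDeriv (0, (w : Space3)) (cDeriv (0, (w : Space3)) (cDeriv (0, (w : Space3)) f)) p|
      ≤ ∑ i, ∑ j, ∑ k, |cDeriv (eX k) (cDeriv (eX j) (cDeriv (eX i) f)) p| := by
  refine (abs_cDeriv_space_le w _ p).trans (Finset.sum_le_sum fun i _ => ?_)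
  rw [cDeriv_comm _ _ isOpen_univ (contDiffOn_cDeriv _ isOpen_univ hf) hp,
    cDeriv_congr _ isOpen_univ (fun q hq => cDeriv_comm (eX i) (0, (w : Space3)) isOpen_univ hf hq)
      hp]
  exact abs_cDeriv_space_two_le w (contDiffOn_cDeriv _ isOpen_univ hf) hp

lemma hasDerivAt_ray (hf : ContDiffOn ℝ ∞ f (futureRegion ∩ Set.univ)) (x v : Space3) (s : ℝ) :
    HasDerivAt (fun s : ℝ => f (0, x + s • v)) (cDeriv (0, v) f (0, x + s • v)) s := by
  have h1 : HasDerivAt (fun s : ℝ => x + s • v) v s := by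
    simpa using ((hasDerivAt_id s).smul_const v).const_add x
  exact HasFDerivAt.comp_hasDerivAt (l := fun y : Space3 => f (0, y)) s
    (hasFDerivAt_slice isOpen_univ hf (mem_future_univ (p := (0, x + s • v)) (le_refl (0 : ℝ)))) h1

lemma continuous_ray (hf : ContDiffOn ℝ ∞ f (futureRegion ∩ Set.univ)) (x v : Space3) :
    Continuous fun s : ℝ => f (0, x + s • v) :=
  continuous_iff_continuousAt.2 fun s => (hasDerivAt_ray hf x v s).continuousAt

/-- A combination of derivatives of the data of `f` whose `L¹` norm controls `f` at later times. -/
noncomputable def dataDensity (f : Spacetime → ℝ) (y : Space3) : ℝ :=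
  (∑ i, |cDeriv (eX i) (cDeriv eT f) (0, y)|)
    + (∑ i, ∑ j, |cDeriv (eX j) (cDeriv (eX i) (cDeriv eT f)) (0, y)|)
    + 2 * (∑ i, ∑ j, |cDeriv (eX j) (cDeriv (eX i) f) (0, y)|)
    + 2 * (∑ i, ∑ j, ∑ k, |cDeriv (eX k) (cDeriv (eX j) (cDeriv (eX i) f)) (0, y)|)

lemma dataDensity_nonneg (f : Spacetime → ℝ) (y : Space3) : 0 ≤ dataDensity f y := by
  unfold dataDensity; positivity

lemma continuous_dataDensity (hf : IsGoodSolution f) : Continuous (dataDensity f) := by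
  have hfU := hf.contDiffOn_univ
  have hc : ∀ {g : Spacetime → ℝ}, ContDiffOn ℝ ∞ g (futureRegion ∩ Set.univ) →
      Continuous fun y : Space3 => |g (0, y)| := fun {g} hg =>
    (continuous_slice (by simpa using hg.continuousOn) le_rfl).abs
  have hs : ∀ {g : Spacetime → ℝ} (e : Spacetime), ContDiffOn ℝ ∞ g (futureRegion ∩ Set.univ) →
      ContDiffOn ℝ ∞ (cDeriv e g) (futureRegion ∩ Set.univ) := fun e hg =>
    contDiffOn_cDeriv e isOpen_univ hg
  unfold dataDensity
  refine ((Continuous.add ?_ ?_).add (continuous_const.mul ?_)).add (continuous_const.mul ?_)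
  · exact continuous_finsetSum _ fun i _ => hc (hs _ (hs _ hfU))
  · exact continuous_finsetSum _ fun i _ => continuous_finsetSum _ fun j _ =>
      hc (hs _ (hs _ (hs _ hfU)))
  · exact continuous_finsetSum _ fun i _ => continuous_finsetSum _ fun j _ => hc (hs _ (hs _ hfU))
  · exact continuous_finsetSum _ fun i _ => continuous_finsetSum _ fun j _ =>
      continuous_finsetSum _ fun k _ => hc (hs _ (hs _ (hs _ hfU)))

/-- The Kirchhoff integrand is controlled by a weighted integral of `dataDensity` along the ray
that leaves the light cone outwards; the weight `s²` is that of polar coordinates about `x`. -/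
lemma IsGoodSolution.abs_kirchhoff_integrand_le (hf : IsGoodSolution f)
    (hd : DataSupportedIn ρ f) {T M : ℝ} (hT : 0 ≤ T) (hTM : T ≤ M) (x : Space3)
    (hM : ρ + ‖x‖ < M) (w : Sphere2) :
    (1 + T) * |f (0, x + T • (w : Space3)) + T * cDeriv (1, (w : Space3)) f
      (0, x + T • (w : Space3))| ≤ ∫ s in T..M, s ^ 2 * dataDensity f (x + s • (w : Space3)) := by
  have hU := isOpen_univ (X := Spacetime)
  have hfU := hf.contDiffOn_univ
  let D : (Spacetime → ℝ) → Spacetime → ℝ := cDeriv (0, (w : Space3))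
  have hDs : ∀ {g}, ContDiffOn ℝ ∞ g (futureRegion ∩ Set.univ) →
      ContDiffOn ℝ ∞ (D g) (futureRegion ∩ Set.univ) := fun hg => contDiffOn_cDeriv _ hU hg
  have hmem : ∀ y : Space3, ((0, y) : Spacetime) ∈ futureRegion ∩ Set.univ :=
    fun y => ⟨le_refl (0 : ℝ), trivial⟩
  have hD0 : ∀ {g}, ContDiffOn ℝ ∞ g (futureRegion ∩ Set.univ) →
      (∀ y : Space3, ρ < ‖y‖ → g (0, y) = 0) → ∀ y : Space3, ρ < ‖y‖ → D g (0, y) = 0 := by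
    intro g hg h0 y hy
    simp only [D]
    rw [cDeriv_space]
    simp [fun i => cDeriv_eX_eq_zero_of_slice hU hg (hmem y) h0 hy i]
  have hTs := contDiffOn_cDeriv eT hU hfU
  have hMx : ρ < ‖x + M • (w : Space3)‖ := by
    have h1 := norm_sub_norm_le (M • (w : Space3)) (-x)
    rw [norm_smul, norm_sphere, norm_neg, sub_neg_eq_add, mul_one, add_comm (M • (w : Space3)),
      Real.norm_of_nonneg (hT.trans hTM)] at h1
    linarith
  have h00 : ∀ y : Space3, ρ < ‖y‖ → f (0, y) = 0 := fun y hy => (hd y hy).1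
  have h10 : ∀ y : Space3, ρ < ‖y‖ → cDeriv eT f (0, y) = 0 := fun y hy => (hd y hy).2
  have r := fun {g} hg => hasDerivAt_ray (f := g) hg x (w : Space3)
  have c := fun {g} hg => continuous_ray (f := g) hg x (w : Space3)
  have s1 := hDs hfU
  have s2 := hDs s1
  have s3 := hDs s2
  have t1 := hDs hTs
  have t2 := hDs t1
  have z1 := hD0 hfU h00
  have z2 := hD0 s1 z1
  have y1 := hD0 hTs h10
  -- `T |u₀|` and `|u₀|`
  have b1 := mul_abs_le_integral hT hTM (r hfU) (r s1) (c s2) (h00 _ hMx) (z1 _ hMx)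
  have b2 := abs_le_integral hT hTM (r hfU) (r s1) (r s2) (c s3) (h00 _ hMx) (z1 _ hMx) (z2 _ hMx)
  -- `T² |∂_r u₀|` and `T |∂_r u₀|`
  have b3 := sq_mul_abs_le_integral hT hTM (r s1) (c s2) (z1 _ hMx)
  have b4 := mul_abs_le_integral hT hTM (r s1) (r s2) (c s3) (z1 _ hMx) (z2 _ hMx)
  -- `T² |u₁|` and `T |u₁|`
  have b5 := sq_mul_abs_le_integral hT hTM (r hTs) (c t1) (h10 _ hMx)
  have b6 := mul_abs_le_integral hT hTM (r hTs) (r t1) (c t2) (h10 _ hMx) (y1 _ hMx)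
  have hint : ∀ {g}, ContDiffOn ℝ ∞ g (futureRegion ∩ Set.univ) →
      IntervalIntegrable (fun s => s ^ 2 * |g (0, x + s • (w : Space3))|) volume T M := fun hg =>
    ((continuous_id.pow 2).mul (c hg).abs).intervalIntegrable _ _
  have hsplit : cDeriv (1, (w : Space3)) f (0, x + T • (w : Space3))
      = cDeriv eT f (0, x + T • (w : Space3)) + D f (0, x + T • (w : Space3)) := by
    have hv : ((1, (w : Space3)) : Spacetime) = eT + (0, (w : Space3)) := by simp [eT]
    rw [hv, cDeriv_vec_add]
  have hle : (1 + T) * |f (0, x + T • (w : Space3)) + T * cDeriv (1, (w : Space3)) f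
      (0, x + T • (w : Space3))| ≤
      ((∫ s in T..M, s ^ 2 * |D (cDeriv eT f) (0, x + s • (w : Space3))|)
      + (∫ s in T..M, s ^ 2 * |D (D (cDeriv eT f)) (0, x + s • (w : Space3))|))
      + 2 * (∫ s in T..M, s ^ 2 * |D (D f) (0, x + s • (w : Space3))|)
      + 2 * (∫ s in T..M, s ^ 2 * |D (D (D f)) (0, x + s • (w : Space3))|) := by
    rw [hsplit]
    have habs : |f (0, x + T • (w : Space3)) + T * (cDeriv eT f (0, x + T • (w : Space3))
        + D f (0, x + T • (w : Space3)))| ≤ |f (0, x + T • (w : Space3))|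
        + T * (|cDeriv eT f (0, x + T • (w : Space3))| + |D f (0, x + T • (w : Space3))|) := by
      refine (abs_add_le _ _).trans (add_le_add le_rfl ?_)
      rw [abs_mul, abs_of_nonneg hT]
      exact mul_le_mul_of_nonneg_left (abs_add_le _ _) hT
    refine (mul_le_mul_of_nonneg_left habs (by linarith)).trans ?_
    linarith
  refine hle.trans ?_
  rw [← intervalIntegral.integral_const_mul, ← intervalIntegral.integral_const_mul,
    ← intervalIntegral.integral_add (hint t1) (hint t2),
    ← intervalIntegral.integral_add ((hint t1).add (hint t2)) ((hint s2).const_mul 2),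
    ← intervalIntegral.integral_add (((hint t1).add (hint t2)).add ((hint s2).const_mul 2))
      ((hint s3).const_mul 2)]
  refine intervalIntegral.integral_mono_on hTM ((((hint t1).add (hint t2)).add
    ((hint s2).const_mul 2)).add ((hint s3).const_mul 2)) ?_ fun s _ => ?_
  · have h := (continuous_dataDensity hf).comp
      (by fun_prop : Continuous fun s : ℝ => x + s • (w : Space3))
    exact ((continuous_id.pow 2).mul h).intervalIntegrable _ _
  · have i1 := abs_cDeriv_space_le w (cDeriv eT f) (0, x + s • (w : Space3))
    have i2 := abs_cDeriv_space_two_le w hTs (hmem (x + s • (w : Space3)))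
    have i3 := abs_cDeriv_space_two_le w hfU (hmem (x + s • (w : Space3)))
    have i4 := abs_cDeriv_space_three_le w hfU (hmem (x + s • (w : Space3)))
    have hs2 := sq_nonneg s
    unfold dataDensity
    have j := mul_le_mul_of_nonneg_left (add_le_add (add_le_add (add_le_add i1 i2)
      (mul_le_mul_of_nonneg_left i3 zero_le_two)) (mul_le_mul_of_nonneg_left i4 zero_le_two)) hs2
    refine le_trans (le_of_eq ?_) j
    simp only [D]
    ring

/-- Decay of solutions with compactly supported data: integrating the bound for the Kirchhoff
integrand over the sphere produces a volume integral in polar coordinates about `x`. -/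
theorem IsGoodSolution.decay (hf : IsGoodSolution f) (hd : DataSupportedIn ρ f)
    (hint : Integrable (dataDensity f)) {T : ℝ} (hT : 0 ≤ T) (x : Space3) :
    sphereMeasure.real Set.univ * ((1 + T) * |f (T, x)|) ≤ ∫ y, dataDensity f y := by
  let k : Sphere2 → ℝ := fun w => (1 + T) * (f (0, x + T • (w : Space3))
    + T * cDeriv (1, (w : Space3)) f (0, x + T • (w : Space3)))
  let Q : Space3 → ENNReal := fun y => ENNReal.ofReal (dataDensity f (x + y))
  have hQ : Measurable Q := by
    have := (continuous_dataDensity hf).measurable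
    fun_prop
  have hk : ∫ w, k w ∂sphereMeasure = (1 + T) * (sphereMeasure.real Set.univ * f (T, x)) := by
    rw [hf.kirchhoff hT x, ← integral_const_mul]
  have hkw : ∀ w, ‖k w‖ₑ ≤ ∫⁻ s in Set.Ioi (0 : ℝ),
      ENNReal.ofReal (s ^ 2) * Q (s • (w : Space3)) := by
    intro w
    -- any radius beyond which the ray has left the support of the data
    obtain ⟨M, hTM, hM⟩ : ∃ M, T ≤ M ∧ ρ + ‖x‖ < M :=
      ⟨max T (ρ + ‖x‖ + 1), le_max_left _ _, lt_of_lt_of_le (by linarith) (le_max_right _ _)⟩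
    have h1 := hf.abs_kirchhoff_integrand_le hd hT hTM x hM w
    have hc : Continuous fun s : ℝ => s ^ 2 * dataDensity f (x + s • (w : Space3)) := by
      have := continuous_dataDensity hf
      fun_prop
    have h2 : ‖k w‖ₑ ≤ ENNReal.ofReal
        (∫ s in T..M, s ^ 2 * dataDensity f (x + s • (w : Space3))) := by
      rw [Real.enorm_eq_ofReal_abs]
      refine ENNReal.ofReal_le_ofReal ?_
      simp only [k]
      rwa [abs_mul, abs_of_nonneg (by linarith : (0 : ℝ) ≤ 1 + T)]
    refine h2.trans ?_
    rw [intervalIntegral.integral_of_le hTM, ofReal_integral_eq_lintegral_ofReal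
      (hc.integrableOn_Ioc) (Eventually.of_forall fun s => mul_nonneg (sq_nonneg s)
        (dataDensity_nonneg f _))]
    refine (lintegral_mono_set (fun s hs => lt_of_le_of_lt hT hs.1)).trans (le_of_eq ?_)
    refine lintegral_congr fun s => ?_
    rw [ENNReal.ofReal_mul (sq_nonneg s)]
  have h1 : ENNReal.ofReal (sphereMeasure.real Set.univ * ((1 + T) * |f (T, x)|))
      ≤ ENNReal.ofReal (∫ y, dataDensity f y) := by
    calc ENNReal.ofReal (sphereMeasure.real Set.univ * ((1 + T) * |f (T, x)|))
        = ‖∫ w, k w ∂sphereMeasure‖ₑ := by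
          rw [hk, Real.enorm_eq_ofReal_abs, abs_mul, abs_mul,
            abs_of_nonneg (by linarith : (0 : ℝ) ≤ 1 + T),
            abs_of_pos sphereMeasure_real_univ_pos]
          congr 1; ring
      _ ≤ ∫⁻ w, ‖k w‖ₑ ∂sphereMeasure := enorm_integral_le_lintegral_enorm _
      _ ≤ ∫⁻ w : Sphere2, (∫⁻ s in Set.Ioi (0 : ℝ),
          ENNReal.ofReal (s ^ 2) * Q (s • (w : Space3))) ∂sphereMeasure := lintegral_mono hkw
      _ = ∫⁻ y, Q y := (lintegral_polar hQ).symm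
      _ = ∫⁻ y, ENNReal.ofReal (dataDensity f y) :=
          lintegral_add_left_eq_self (fun y => ENNReal.ofReal (dataDensity f y)) x
      _ = ENNReal.ofReal (∫ y, dataDensity f y) :=
          (ofReal_integral_eq_lintegral_ofReal hint
            (Eventually.of_forall (dataDensity_nonneg f))).symm
  exact (ENNReal.ofReal_le_ofReal_iff (integral_nonneg (dataDensity_nonneg f))).1 h1

/-- Cauchy–Schwarz on a ball. -/
lemma sq_integral_abs_le {a : Space3 → ℝ} {r : ℝ} (ha : Continuous a)
    (h0 : ∀ x, r < ‖x‖ → a x = 0) :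
    (∫ x, |a x|) ^ 2 ≤ (volume : Measure Space3).real (Metric.closedBall 0 r) * ∫ x, a x ^ 2 := by
  set K := Metric.closedBall (0 : Space3) r
  have hK : IsCompact K := isCompact_closedBall _ _
  have hout : ∀ x ∉ K, a x = 0 := fun x hx => h0 x (by simpa [K] using hx)
  have e1 : ∫ x in K, |a x| = ∫ x, |a x| :=
    setIntegral_eq_integral_of_forall_compl_eq_zero fun x hx => by simp [hout x hx]
  have e2 : ∫ x in K, a x ^ 2 = ∫ x, a x ^ 2 :=
    setIntegral_eq_integral_of_forall_compl_eq_zero fun x hx => by simp [hout x hx]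
  rw [← e1, ← e2]
  have i1 : IntegrableOn (fun x => |a x|) K := ha.abs.continuousOn.integrableOn_compact hK
  have i2 : IntegrableOn (fun x => a x ^ 2) K := (ha.pow 2).continuousOn.integrableOn_compact hK
  set A := ∫ x in K, |a x|
  set S := ∫ x in K, a x ^ 2
  set V := (volume : Measure Space3).real K
  have key : ∀ t : ℝ, 0 ≤ S - 2 * t * A + t ^ 2 * V := by
    intro t
    have h1 : 0 ≤ ∫ x in K, (|a x| - t) ^ 2 := integral_nonneg fun x => sq_nonneg _
    have h2 : ∀ x, (|a x| - t) ^ 2 = (a x ^ 2 - 2 * t * |a x|) + t ^ 2 := fun x => by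
      rw [← sq_abs (a x)]; ring
    have i3 : IntegrableOn (fun _ : Space3 => t ^ 2) K :=
      continuous_const.continuousOn.integrableOn_compact hK
    have i4 : Integrable (fun x => a x ^ 2 - 2 * t * |a x|) (volume.restrict K) :=
      Integrable.sub i2 (Integrable.const_mul i1 (2 * t))
    simp only [h2] at h1
    rw [integral_add i4 i3, integral_sub i2 (i1.const_mul (2 * t)),
      integral_const_mul, setIntegral_const, smul_eq_mul] at h1
    linarith
  have hV : 0 ≤ V := measureReal_nonneg
  rcases hV.eq_or_lt with hV0 | hV0
  · have hA : A = 0 := by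
      have hm : volume K = 0 :=
        (measureReal_eq_zero_iff (hK.measure_lt_top.ne)).1 hV0.symm
      simp only [A]
      rw [Measure.restrict_eq_zero.2 hm, integral_zero_measure]
    rw [hA, ← hV0]; simp
  · have h := key (A / V)
    have h' : S - 2 * (A / V) * A + (A / V) ^ 2 * V = S - A ^ 2 / V := by field_simp; ring
    rw [h', sub_nonneg, div_le_iff₀ hV0] at h
    linarith

/-- The `L¹` norm of a spatial derivative of compactly supported data is bounded by the energy. -/
lemma IsGoodSolution.integral_abs_cDeriv_le (hf : IsGoodSolution f)
    (h0 : ∀ T : ℝ, 0 ≤ T → ∀ x : Space3, ρ + T < ‖x‖ → f (T, x) = 0) (i : Fin 3) :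
    Integrable (fun y : Space3 => |cDeriv (eX i) f (0, y)|) ∧
    ∫ y : Space3, |cDeriv (eX i) f (0, y)| ≤
      √(2 * (volume : Measure Space3).real (Metric.closedBall 0 ρ)) * energy f 0 := by
  have hc : Continuous fun y : Space3 => cDeriv (eX i) f (0, y) :=
    continuous_slice (by simpa using
      (contDiffOn_cDeriv (eX i) isOpen_univ hf.contDiffOn_univ).continuousOn) le_rfl
  have hz : ∀ y : Space3, ρ < ‖y‖ → cDeriv (eX i) f (0, y) = 0 := fun y hy =>
    cDeriv_eq_zero_of_finite_speed h0 (eX i) le_rfl (by simpa using hy)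
  have hcs := hasCompactSupport_of_eq_zero hz
  refine ⟨(hc.integrable_of_hasCompactSupport hcs).abs, ?_⟩
  set V := (volume : Measure Space3).real (Metric.closedBall 0 ρ)
  have hV : 0 ≤ V := measureReal_nonneg
  have h1 := sq_integral_abs_le hc hz
  have hi2 : Integrable fun y : Space3 => cDeriv (eX i) f (0, y) ^ 2 :=
    (hc.pow 2).integrable_of_hasCompactSupport (hasCompactSupport_of_eq_zero (r := ρ)
      fun y hy => by simp [hz y hy])
  have h2 : ∫ y : Space3, cDeriv (eX i) f (0, y) ^ 2 ≤ ∫ y, energyDensity f 0 y := by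
    refine integral_mono hi2 (hf.integrable_energyDensity h0 le_rfl) fun y => ?_
    have := Finset.single_le_sum (f := fun i => cDeriv (eX i) f (0, y) ^ 2)
      (fun i _ => sq_nonneg _) (Finset.mem_univ i)
    rw [energyDensity_eq]
    have h3 := sq_nonneg (cDeriv eT f (0, y))
    simp only at this ⊢
    linarith
  have h3 : energy f 0 ^ 2 = 1 / 2 * ∫ y, energyDensity f 0 y :=
    Real.sq_sqrt (mul_nonneg (by norm_num) (integral_nonneg (energyDensity_nonneg f 0)))
  refine (le_abs_self _).trans (abs_le_of_sq_le_sq ?_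
    (mul_nonneg (Real.sqrt_nonneg _) (energy_nonneg f 0)))
  rw [mul_pow, Real.sq_sqrt (by positivity), h3]
  refine h1.trans ((mul_le_mul_of_nonneg_left h2 hV).trans (le_of_eq ?_))
  ring

lemma energy_gammaPow_le (f : Spacetime → ℝ) (I : List GammaIdx) (hI : I.length ≤ 2) :
    energy (gammaPow I f) 0 ≤ initialGammaEnergy f := by
  have h1 : energy (gammaPow I f) 0 ≤
      ∑ J : Fin I.length → GammaIdx, energy (gammaPow (List.ofFn J) f) 0 := by
    have := Finset.single_le_sum (f := fun J : Fin I.length → GammaIdx =>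
      energy (gammaPow (List.ofFn J) f) 0) (fun J _ => energy_nonneg _ _)
      (Finset.mem_univ I.get)
    simpa [List.ofFn_get] using this
  refine h1.trans ?_
  exact Finset.single_le_sum (f := fun k => ∑ J : Fin k → GammaIdx,
    energy (gammaPow (List.ofFn J) f) 0)
    (fun k _ => Finset.sum_nonneg fun J _ => energy_nonneg _ _)
    (Finset.mem_range.2 (by omega))

/-- Every term of `dataDensity` is a spatial derivative of some `Γ^I f` with `|I| ≤ 2`, the
fields being translations. -/
lemma IsGoodSolution.integral_dataDensity_le (hf : IsGoodSolution f)
    (hd : DataSupportedIn ρ f) :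
    Integrable (dataDensity f) ∧ ∫ y, dataDensity f y ≤
      84 * (√(2 * (volume : Measure Space3).real (Metric.closedBall 0 ρ)) *
        initialGammaEnergy f) := by
  set c := √(2 * (volume : Measure Space3).real (Metric.closedBall 0 ρ)) * initialGammaEnergy f
  have hterm : ∀ (I : List GammaIdx), I.length ≤ 2 → ∀ i : Fin 3,
      Integrable (fun y : Space3 => |cDeriv (eX i) (_root_.gammaPow I f) (0, y)|) ∧
      ∫ y : Space3, |cDeriv (eX i) (_root_.gammaPow I f) (0, y)| ≤ c := by
    intro I hI i
    have h := (hf.gammaPow I).integral_abs_cDeriv_le (ρ := ρ)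
      (fun T hT x hx => hf.gammaPow_eq_zero hd I hT hx) i
    exact ⟨h.1, h.2.trans (mul_le_mul_of_nonneg_left (energy_gammaPow_le f I hI)
      (Real.sqrt_nonneg _))⟩
  have hsum : ∀ {a : Fin 3 → Space3 → ℝ} {b : ℝ},
      (∀ i, Integrable (a i) ∧ ∫ y, a i y ≤ b) →
      Integrable (fun y => ∑ i, a i y) ∧ ∫ y, ∑ i, a i y ≤ 3 * b := by
    intro a b h
    refine ⟨integrable_finsetSum _ fun i _ => (h i).1, ?_⟩
    rw [integral_finsetSum _ fun i _ => (h i).1, Fin.sum_univ_three]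
    linarith [(h 0).2, (h 1).2, (h 2).2]
  have hadd : ∀ {a a' : Space3 → ℝ} {b b' : ℝ}, (Integrable a ∧ ∫ y, a y ≤ b) →
      (Integrable a' ∧ ∫ y, a' y ≤ b') →
      Integrable (fun y => a y + a' y) ∧ ∫ y, (a y + a' y) ≤ b + b' := fun h h' =>
    ⟨h.1.add h'.1, (integral_add h.1 h'.1).trans_le (add_le_add h.2 h'.2)⟩
  have htwo : ∀ {a : Space3 → ℝ} {b : ℝ}, (Integrable a ∧ ∫ y, a y ≤ b) →
      Integrable (fun y => 2 * a y) ∧ ∫ y, 2 * a y ≤ 2 * b := fun h =>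
    ⟨h.1.const_mul 2, (integral_const_mul _ _).trans_le (mul_le_mul_of_nonneg_left h.2 zero_le_two)⟩
  have k1 := hsum fun i => hterm [.timeTranslation] (by simp) i
  have k2 := hsum fun i => hsum fun j => hterm [.translation i, .timeTranslation] (by simp) j
  have k3 := hsum fun i => hsum fun j => hterm [.translation i] (by simp) j
  have k4 := hsum fun i => hsum fun j => hsum fun k =>
    hterm [.translation j, .translation i] (by simp) k
  have h := hadd (hadd (hadd k1 k2) (htwo k3)) (htwo k4)
  exact ⟨h.1, h.2.trans (by linarith)⟩

end Data

/-! ### An outgoing spherical wave -/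

/-- The retarded profile `H(T - R)`. -/
noncomputable def retarded (H : ℝ → ℝ) : Spacetime → ℝ := fun p => H (p.1 - radius p)

/-- The outgoing spherical wave `H(T - R) / R`. -/
noncomputable def outgoingWave (H : ℝ → ℝ) : Spacetime → ℝ := fun p => retarded H p * (radius p)⁻¹

section Outgoing

variable {H : ℝ → ℝ} {p : Spacetime}

lemma contDiffOn_retarded (hH : ContDiff ℝ ∞ H) :
    ContDiffOn ℝ ∞ (retarded H) (futureRegion ∩ offAxis) :=
  hH.comp_contDiffOn (contDiff_fst.contDiffOn.sub contDiffOn_radius)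

lemma cDeriv_retarded (hH : ContDiff ℝ ∞ H) (e : Spacetime) (hp : p ∈ futureRegion ∩ offAxis) :
    cDeriv e (retarded H) p = retarded (deriv H) p * (e.1 - cDeriv e radius p) := by
  have h1 : HasFDerivWithinAt (fun q : Spacetime => q.1 - radius q) _ futureRegion p :=
    hasFDerivWithinAt_fst.fun_sub
      (hasFDerivWithinAt_future isOpen_offAxis contDiffOn_radius hp)
  have h2 := ((hH.differentiable (by simp)) (p.1 - radius p)).hasDerivAt.comp_hasFDerivWithinAt p h1
  change fderivWithin ℝ (H ∘ fun q : Spacetime => q.1 - radius q) futureRegion p e = _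
  rw [h2.fderivWithin (uniqueDiffOn_futureRegion p hp.1)]
  rfl

lemma contDiff_deriv_of_contDiff (hH : ContDiff ℝ ∞ H) : ContDiff ℝ ∞ (deriv H) :=
  (contDiff_infty_iff_deriv.1 hH).2

lemma sum_cDeriv_radius_sq (hp : p ∈ futureRegion ∩ offAxis) :
    ∑ i, cDeriv (eX i) radius p * cDeriv (eX i) radius p = 1 := by
  have hR : radius p ≠ 0 := norm_ne_zero_iff.2 hp.2
  have h := sum_sq_eq_radius p
  simp only [cDeriv_eX_radius _ hp, Fin.sum_univ_three] at h ⊢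
  field_simp
  linarith

lemma waveOp_retarded (hH : ContDiff ℝ ∞ H) (hp : p ∈ futureRegion ∩ offAxis) :
    waveOp (retarded H) p = -(2 * (radius p)⁻¹ * retarded (deriv H) p) := by
  have hU := isOpen_offAxis
  have hH' := contDiff_deriv_of_contDiff hH
  have key : ∀ e, cDeriv e (cDeriv e (retarded H)) p =
      retarded (deriv (deriv H)) p * ((e.1 - cDeriv e radius p) * (e.1 - cDeriv e radius p))
        - retarded (deriv H) p * cDeriv e (cDeriv e radius) p := by
    intro e
    have hs := contDiffOn_cDeriv e hU contDiffOn_radius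
    rw [cDeriv_congr e hU (fun q hq => cDeriv_retarded hH e hq) hp,
      cDeriv_mul e hU (contDiffOn_retarded hH') (contDiffOn_const.sub hs) hp,
      cDeriv_retarded hH' e hp, cDeriv_sub e hU contDiffOn_const hs hp, cDeriv_const]
    ring
  have h1 := sum_cDeriv_radius_sq hp
  have h2 := waveOp_radius hp
  have h3 := cDeriv_eT_radius hp
  rw [waveOp_eq] at h2 ⊢
  simp only [key, h3, Fin.sum_univ_three, eT_fst, eX_fst] at h1 h2 ⊢
  linear_combination (retarded (deriv (deriv H)) p) * h1 - (retarded (deriv H) p) * h2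

lemma waveOp_radius_inv (hp : p ∈ futureRegion ∩ offAxis) :
    waveOp (fun q => (radius q)⁻¹) p = 0 := by
  have hU := isOpen_offAxis
  have hR : radius p ≠ 0 := norm_ne_zero_iff.2 hp.2
  have h1 := waveOp_mul hU contDiffOn_radius contDiffOn_radius_inv hp
  have h2 : Set.EqOn (fun q => radius q * (radius q)⁻¹) (fun _ => 1) (futureRegion ∩ offAxis) :=
    fun q hq => mul_inv_cancel₀ (norm_ne_zero_iff.2 hq.2)
  have h3 : waveOp (fun _ => (1 : ℝ)) p = 0 := by
    have : ∀ e, cDeriv e (fun _ => (1 : ℝ)) = fun _ => 0 := fun e => funext (cDeriv_const e 1)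
    simp [waveOp_eq, this, cDeriv_const]
  have h4 := sum_cDeriv_radius_sq hp
  rw [waveOp_congr hU h2 hp, h3, waveOp_radius hp] at h1
  simp only [cDeriv_radius_inv _ hp, cDeriv_eT_radius hp, Fin.sum_univ_three] at h1 h4
  have h5 : radius p * waveOp (fun q => (radius q)⁻¹) p = 0 := by
    linear_combination -h1 + 2 * ((radius p)⁻¹ * (radius p)⁻¹) * h4
  exact (mul_eq_zero.1 h5).resolve_left hR

lemma waveOp_outgoingWave (hH : ContDiff ℝ ∞ H) (hp : p ∈ futureRegion ∩ offAxis) :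
    waveOp (outgoingWave H) p = 0 := by
  have h4 := sum_cDeriv_radius_sq hp
  have h1 : waveOp (outgoingWave H) p = _ :=
    waveOp_mul isOpen_offAxis (contDiffOn_retarded hH) contDiffOn_radius_inv hp
  rw [h1, waveOp_radius_inv hp, waveOp_retarded hH hp]
  simp only [cDeriv_radius_inv _ hp, cDeriv_retarded hH _ hp, cDeriv_eT_radius hp,
    Fin.sum_univ_three, eX_fst] at h4 ⊢
  linear_combination (2 * retarded (deriv H) p * ((radius p)⁻¹ * (radius p)⁻¹)) * h4

lemma outgoingWave_eq_zero (h : H (p.1 - ‖p.2‖) = 0) : outgoingWave H p = 0 := by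
  simp only [outgoingWave, retarded, radius, h, zero_mul]

/-- If `H` vanishes on `[-1, ∞)` the outgoing wave vanishes near the axis at all times `T ≥ 0`, so
that the singularity of `1 / R` is invisible. -/
lemma isGoodSolution_outgoingWave (hH : ContDiff ℝ ∞ H) (h0 : ∀ s, -1 ≤ s → H s = 0) :
    IsGoodSolution (outgoingWave H) := by
  have hV : IsOpen {q : Spacetime | -1 < q.1 - ‖q.2‖} := isOpen_lt (by fun_prop) (by fun_prop)
  have hz : Set.EqOn (outgoingWave H) (fun _ => 0)
      (futureRegion ∩ {q : Spacetime | -1 < q.1 - ‖q.2‖}) := fun q hq =>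
    outgoingWave_eq_zero (h0 _ (show -1 < q.1 - ‖q.2‖ from hq.2).le)
  have haxis : ∀ p ∈ futureRegion, p.2 = 0 →
      p ∈ futureRegion ∩ {q : Spacetime | -1 < q.1 - ‖q.2‖} := fun p hp h2 => by
    have hp' : 0 ≤ p.1 := hp
    refine ⟨hp, ?_⟩
    change -1 < p.1 - ‖p.2‖
    rw [h2, norm_zero]
    linarith
  refine ⟨fun p hp => ?_, fun p hp => ?_⟩
  · by_cases h2 : p.2 = 0
    · have hmem := haxis p hp h2
      refine (contDiffWithinAt_const (c := (0 : ℝ))).congr_of_eventuallyEq ?_ (hz hmem)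
      filter_upwards [inter_mem_nhdsWithin_future hV hmem] with q hq using hz hq
    · exact contDiffWithinAt_future isOpen_offAxis
        ((contDiffOn_retarded hH).mul contDiffOn_radius_inv) ⟨hp, h2⟩
  · by_cases h2 : p.2 = 0
    · have : ∀ e, cDeriv e (fun _ => (0 : ℝ)) = fun _ => 0 := fun e => funext (cDeriv_const e 0)
      rw [waveOp_congr hV hz (haxis p hp h2)]
      simp [waveOp_eq, this]
    · exact waveOp_outgoingWave hH ⟨hp, h2⟩

lemma dataSupportedIn_outgoingWave (h0 : ∀ s, s ≤ -2 → H s = 0) :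
    DataSupportedIn 2 (outgoingWave H) := by
  have hV : IsOpen {q : Spacetime | q.1 - ‖q.2‖ < -2} := isOpen_lt (by fun_prop) (by fun_prop)
  have hz : Set.EqOn (outgoingWave H) (fun _ => 0)
      (futureRegion ∩ {q : Spacetime | q.1 - ‖q.2‖ < -2}) := fun q hq =>
    outgoingWave_eq_zero (h0 _ (show q.1 - ‖q.2‖ < -2 from hq.2).le)
  intro X hX
  have hp : ((0, X) : Spacetime) ∈ futureRegion ∩ {q : Spacetime | q.1 - ‖q.2‖ < -2} := by
    refine ⟨le_refl (0 : ℝ), ?_⟩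
    change (0 : ℝ) - ‖X‖ < -2
    linarith
  exact ⟨hz hp, by rw [dirDeriv_vecT, cDeriv_congr eT hV hz hp, cDeriv_const]⟩

/-- `R ∇_ψ̄ (H(T - R) / R) = 2 H'(T - R) + H(T - R) / R`. -/
lemma radius_mul_dirDeriv_outgoingWave (hH : ContDiff ℝ ∞ H) (hp : p ∈ futureRegion ∩ offAxis) :
    radius p * dirDeriv vecPsiBar (outgoingWave H) p =
      2 * retarded (deriv H) p + retarded H p * (radius p)⁻¹ := by
  have hR : radius p ≠ 0 := norm_ne_zero_iff.2 hp.2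
  have hr : cDeriv (vecPsiBar p) radius p = -1 := by
    have h := sum_sq_eq_radius p
    rw [cDeriv_radius _ hp]
    simp only [vecPsiBar, PiLp.neg_apply, PiLp.smul_apply, smul_eq_mul, Fin.sum_univ_three] at h ⊢
    change (p.2 0 * -((radius p)⁻¹ * p.2 0) + p.2 1 * -((radius p)⁻¹ * p.2 1)
      + p.2 2 * -((radius p)⁻¹ * p.2 2)) * (radius p)⁻¹ = -1
    field_simp
    linarith
  have h1 : cDeriv (vecPsiBar p) (outgoingWave H) p = _ :=
    cDeriv_mul _ isOpen_offAxis (contDiffOn_retarded hH) contDiffOn_radius_inv hp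
  rw [dirDeriv_eq_cDeriv, h1, cDeriv_retarded hH _ hp, cDeriv_radius_inv _ hp, hr]
  have hv : (vecPsiBar p).1 = 1 := rfl
  rw [hv]
  field_simp
  ring

lemma tendsto_outgoingWave (hH : ContDiff ℝ ∞ H) (u : ℝ) {e : Space3} (he : ‖e‖ = 1) :
    Tendsto (fun R : ℝ => R * dirDeriv vecPsiBar (outgoingWave H) (u + R, R • e)) atTop
      (𝓝 (2 * deriv H u)) := by
  have h1 : Tendsto (fun R : ℝ => 2 * deriv H u + H u * R⁻¹) atTop (𝓝 (2 * deriv H u)) := by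
    simpa using (tendsto_inv_atTop_zero.const_mul (H u)).const_add (2 * deriv H u)
  refine h1.congr' ?_
  filter_upwards [eventually_gt_atTop 0, eventually_ge_atTop (-u)] with R hR hRu
  have hrad : radius (u + R, R • e) = R := by
    simp [radius, norm_smul, he, abs_of_pos hR]
  have hp : ((u + R, R • e) : Spacetime) ∈ futureRegion ∩ offAxis := by
    refine ⟨by change 0 ≤ u + R; linarith, ?_⟩
    exact smul_ne_zero hR.ne' (norm_ne_zero_iff.1 (by rw [he]; exact one_ne_zero))
  have h := radius_mul_dirDeriv_outgoingWave hH hp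
  have hret : ∀ F : ℝ → ℝ, retarded F (u + R, R • e) = F u := fun F => by
    simp [retarded, hrad]
  rw [hret, hret, hrad] at h
  exact h.symm

end Outgoing

/-- A good field for which `R ∇_ψ̄ g` has a nonzero limit along an outgoing null ray. -/
theorem exists_good_solution_tendsto_ne_zero :
    ∃ (g : Spacetime → ℝ) (ρ u c : ℝ) (e : Space3),
      IsGoodSolution g ∧ DataSupportedIn ρ g ∧ ‖e‖ = 1 ∧ c ≠ 0 ∧
      Tendsto (fun R : ℝ => R * dirDeriv vecPsiBar g (u + R, R • e)) atTop (𝓝 c) := by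
  let b : ContDiffBump (-(3 / 2) : ℝ) := ⟨1 / 4, 1 / 2, by norm_num, by norm_num⟩
  have hb : ContDiff ℝ ∞ b := b.contDiff
  have hout : ∀ s : ℝ, 1 / 2 ≤ |s + 3 / 2| → b s = 0 := fun s hs =>
    b.zero_of_le_dist (by rw [Real.dist_eq, sub_neg_eq_add]; exact hs)
  have h1 : ∀ s : ℝ, -1 ≤ s → b s = 0 := fun s hs =>
    hout s (le_trans (by linarith) (le_abs_self _))
  have h2 : ∀ s : ℝ, s ≤ -2 → b s = 0 := fun s hs =>
    hout s (le_trans (by linarith) (neg_le_abs _))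
  -- the profile falls from `1` to `0` between `-3/2` and `-1`
  obtain ⟨u, -, hu⟩ := exists_deriv_eq_slope b (a := -(3 / 2)) (b := -1) (by norm_num)
    hb.continuous.continuousOn (hb.differentiable (by simp)).differentiableOn
  have hu0 : deriv b u ≠ 0 := by
    rw [hu, h1 (-1) le_rfl, b.one_of_mem_closedBall (Metric.mem_closedBall_self b.rIn_pos.le)]
    norm_num
  refine ⟨outgoingWave b, 2, u, 2 * deriv b u, spaceBasis 0, isGoodSolution_outgoingWave hb h1,
    dataSupportedIn_outgoingWave h2, by simp [spaceBasis], mul_ne_zero two_ne_zero hu0,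
    tendsto_outgoingWave hb u (by simp [spaceBasis])⟩

/-! ### Improved decay of ugly fields -/

/-- Solutions with data supported in a ball of radius `ρ` satisfy the weighted bound; since they
vanish for `|T - R| > ρ`, the weights cost only a constant times `1 + T`. -/
lemma IsGoodSolution.weighted_bound {f : Spacetime → ℝ} {ρ : ℝ} (hρ : 0 ≤ ρ)
    (hf : IsGoodSolution f) (hd : DataSupportedIn ρ f) {T : ℝ} (hT : 0 ≤ T) (X : Space3) :
    (1 + T + ‖X‖) * √(1 + |T - ‖X‖|) * |f (T, X)| ≤
      (2 + ρ) * (1 + ρ) * ((sphereMeasure.real Set.univ)⁻¹ *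
        (84 * √(2 * (volume : Measure Space3).real (Metric.closedBall 0 ρ)))) *
        initialGammaEnergy f := by
  have hE : 0 ≤ initialGammaEnergy f :=
    Finset.sum_nonneg fun k _ => Finset.sum_nonneg fun I _ => energy_nonneg _ _
  have hm := sphereMeasure_real_univ_pos
  by_cases h : ρ < |T - ‖X‖|
  · rw [hf.huygens hd hT h, abs_zero, mul_zero]
    positivity
  rw [not_lt] at h
  obtain ⟨hint, hle⟩ := hf.integral_dataDensity_le hd
  have hdec := (hf.decay hd hint hT X).trans hle
  have hX : ‖X‖ ≤ T + ρ := by linarith [(abs_le.1 h).1]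
  have hs : √(1 + |T - ‖X‖|) ≤ 1 + ρ :=
    Real.sqrt_le_iff.2 ⟨by linarith, by nlinarith⟩
  have hw : (1 + T + ‖X‖) * √(1 + |T - ‖X‖|) ≤ (2 + ρ) * (1 + T) * (1 + ρ) :=
    mul_le_mul (by nlinarith [mul_nonneg hρ hT]) hs (Real.sqrt_nonneg _) (by positivity)
  have hdec' : (1 + T) * |f (T, X)| ≤ (sphereMeasure.real Set.univ)⁻¹ *
      (84 * (√(2 * (volume : Measure Space3).real (Metric.closedBall 0 ρ)) *
        initialGammaEnergy f)) := by
    rw [inv_mul_eq_div, le_div_iff₀ hm]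
    linarith
  calc (1 + T + ‖X‖) * √(1 + |T - ‖X‖|) * |f (T, X)|
      ≤ (2 + ρ) * (1 + T) * (1 + ρ) * |f (T, X)| :=
        mul_le_mul_of_nonneg_right hw (abs_nonneg _)
    _ = (2 + ρ) * (1 + ρ) * ((1 + T) * |f (T, X)|) := by ring
    _ ≤ (2 + ρ) * (1 + ρ) * ((sphereMeasure.real Set.univ)⁻¹ *
      (84 * (√(2 * (volume : Measure Space3).real (Metric.closedBall 0 ρ)) *
        initialGammaEnergy f))) := mul_le_mul_of_nonneg_left hdec' (by positivity)
    _ = _ := by ring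

theorem mainTheorem2 :
    (∀ ρ : ℝ, ∃ C : ℝ, ∀ φ : Spacetime → ℝ,
      IsUglySolution 1 (fun _ => 0) φ →
      ContDiffOn ℝ ∞ (rescaledPsiBar φ) futureRegion →
      DataSupportedIn ρ φ →
        (∀ x ∈ futureRegion, waveOp (rescaledPsiBar φ) x = 0) ∧
        (∀ I : List GammaIdx,
          IsGoodSolution (gammaPow I (rescaledPsiBar φ)) ∧
          ∀ T : ℝ, 0 ≤ T →
            Integrable (energyDensity (gammaPow I (rescaledPsiBar φ)) T) ∧
            energy (gammaPow I (rescaledPsiBar φ)) T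
              = energy (gammaPow I (rescaledPsiBar φ)) 0) ∧
        (∀ (T : ℝ) (X : Space3), 0 ≤ T →
          (1 + T + ‖X‖) * Real.sqrt (1 + |T - ‖X‖|) * |rescaledPsiBar φ (T, X)|
            ≤ C * initialGammaEnergy (rescaledPsiBar φ)) ∧
        (∀ (T : ℝ) (X : Space3), 0 ≤ T → X ≠ 0 →
          |dirDeriv vecPsiBar φ (T, X)|
            ≤ C * initialGammaEnergy (rescaledPsiBar φ) / (‖X‖ * (1 + T + ‖X‖)))) ∧
    (∃ (g : Spacetime → ℝ) (ρ u c : ℝ) (e : Space3),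
      IsGoodSolution g ∧ DataSupportedIn ρ g ∧ ‖e‖ = 1 ∧ c ≠ 0 ∧
      Tendsto (fun R : ℝ => R * dirDeriv vecPsiBar g (u + R, R • e)) atTop (𝓝 c)) := by
  refine ⟨fun ρ => ?_, exists_good_solution_tendsto_ne_zero⟩
  -- nothing is lost by enlarging the support radius to be nonnegative
  obtain ⟨σ, hσ, hρσ⟩ : ∃ σ : ℝ, 0 ≤ σ ∧ ρ ≤ σ := ⟨max ρ 0, le_max_right _ _, le_max_left _ _⟩
  refine ⟨(2 + σ) * (1 + σ) * ((sphereMeasure.real Set.univ)⁻¹ *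
    (84 * √(2 * (volume : Measure Space3).real (Metric.closedBall 0 σ)))), fun φ hφ hs hd => ?_⟩
  have hf := hφ.isGoodSolution_rescaledPsiBar hs
  have hdf := hφ.dataSupportedIn_rescaledPsiBar hσ (hd.mono hρσ)
  have hbound := fun (T : ℝ) (X : Space3) (hT : 0 ≤ T) => hf.weighted_bound hσ hdf hT X
  refine ⟨hf.eqn, fun I => ⟨hf.gammaPow I, fun T hT => ?_⟩, hbound, fun T X hT hX => ?_⟩
  · have h0 := fun (T : ℝ) (hT : 0 ≤ T) (x : Space3) (hx : σ + T < ‖x‖) =>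
      hf.gammaPow_eq_zero hdf I hT hx
    exact ⟨(hf.gammaPow I).integrable_energyDensity h0 hT, (hf.gammaPow I).energy_eq h0 hT⟩
  · have hR : 0 < ‖X‖ := norm_pos_iff.2 hX
    have hb := hbound T X hT
    have hone : 1 ≤ √(1 + |T - ‖X‖|) := Real.one_le_sqrt.2 (by linarith [abs_nonneg (T - ‖X‖)])
    have habs : |rescaledPsiBar φ (T, X)| = ‖X‖ * |dirDeriv vecPsiBar φ (T, X)| := by
      rw [rescaledPsiBar, abs_mul, abs_of_pos hR]
    rw [le_div_iff₀ (by positivity)]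
    refine le_trans ?_ hb
    rw [habs]
    calc |dirDeriv vecPsiBar φ (T, X)| * (‖X‖ * (1 + T + ‖X‖))
        = (1 + T + ‖X‖) * 1 * (‖X‖ * |dirDeriv vecPsiBar φ (T, X)|) := by ring
      _ ≤ (1 + T + ‖X‖) * √(1 + |T - ‖X‖|) * (‖X‖ * |dirDeriv vecPsiBar φ (T, X)|) := by
        gcongr
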